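/- For $n \in \mathbb{N}$ and $m,\rho,\delta\in\mathbb{R}$ let $BS^m_{\rho,\delta}(\mathbb{R}^n)$ be the class of all $\sigma(x,\xi,\eta) \in C^\infty(\mathbb{R}^n\times\mathbb{R}^n\times\mathbb{R}^n)$ (complex valued) such that for all multi-indices $\alpha,\beta,\gamma$ there is a constant $C_{\alpha,\beta,\gamma}>0$ with \[ |\partial_x^\alpha\partial_\xi^\beta\partial_\eta^\gamma\sigma(x,\xi,\eta)| \le C_{\alpha,\beta,\gamma}(1+|\xi|+|\eta|)^{m+\delta|\alpha|-\rho(|\beta|+|\gamma|)} \] for all $x,\xi,\eta\in\mathbb{R}^n$. For such $\sigma$ and for Schwartz functions $f,g\in\mathcal{S}(\mathbb{R}^n)$ put \[ T_\sigma(f,g)(x)=\frac{1}{(2\pi)^{2n}}\int_{\mathbb{R}^n\times\mathbb{R}^n} e^{ix\cdot(\xi+\eta)}\sigma(x,\xi,\eta)\widehat f(\xi)\widehat g(\eta)\,d\xi\,d\eta, \qquad \widehat f(\xi)=\int_{\mathbb{R}^n} e^{-ix\cdot\xi}f(x)\,dx . \] $BMO(\mathbb{R}^n)$ is the space of locally integrable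 $h$ with $\|h\|_{BMO}=\sup_Q\frac{1}{|Q|}\int_Q|h(x)-h_Q|\,dx<\infty$, where $Q$ runs over all cubes with sides parallel to the axes and $h_Q$ is the average of $h$ over $Q$. **Theorem.** Let $0\le\rho<1$ and $m=-(1-\rho)n$. Then for every $\sigma\in BS^m_{\rho,\rho}(\mathbb{R}^n)$ the operator $T_\sigma$ is bounded from $L^\infty(\mathbb{R}^n)\times L^\infty(\mathbb{R}^n)$ to $BMO(\mathbb{R}^n)$; that is, there is a constant $A_\sigma$ such that for all $f,g\in\mathcal{S}(\mathbb{R}^n)$ one has $T_\sigma(f,g)\in BMO(\mathbb{R}^n)$ and \[ \|T_\sigma(f,g)\|_{BMO}\le A_\sigma\|f\|_{L^\infty}\|g\|_{L^\infty}. \] -/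

import Mathlib

open MeasureTheory
open scoped ENNReal NNReal

noncomputable section

namespace BilinearPDO

/-- The space `ℝⁿ` with its Euclidean norm, inner product and Lebesgue measure. -/
abbrev Rn (n : ℕ) : Type := EuclideanSpace ℝ (Fin n)

/-- The derivative of `F` in the direction `v`. -/
def dirDeriv {V : Type*} [NormedAddCommGroup V] [NormedSpace ℝ V] (v : V) (F : V → ℂ) : V → ℂ :=
  fun p => fderiv ℝ F p v

/-- The iterated derivative `∂_{v₁}^{α₁} ⋯ ∂_{vₙ}^{αₙ} F` along the directions `v₁, …, vₙ`,
for a multi-index `α`. -/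
def multiDeriv {V : Type*} [NormedAddCommGroup V] [NormedSpace ℝ V] {n : ℕ}
    (v : Fin n → V) (α : Fin n → ℕ) (F : V → ℂ) : V → ℂ :=
  (List.finRange n).foldr (fun i G => (dirDeriv (v i))^[α i] G) F

/-- The standard basis vectors of `ℝⁿ`. -/
def stdVec {n : ℕ} (i : Fin n) : Rn n := EuclideanSpace.single i 1

/-- The mixed partial derivative `∂_x^α ∂_ξ^β ∂_η^γ σ` of a function `σ(x, ξ, η)`. -/
def mixedDeriv {n : ℕ} (α β γ : Fin n → ℕ) (σ : Rn n × Rn n × Rn n → ℂ) :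
    Rn n × Rn n × Rn n → ℂ :=
  multiDeriv (fun i => (stdVec i, 0, 0)) α
    (multiDeriv (fun i => (0, stdVec i, 0)) β
      (multiDeriv (fun i => (0, 0, stdVec i)) γ σ))

/-- The length `|α|` of a multi-index. -/
def multiLen {n : ℕ} (α : Fin n → ℕ) : ℕ := ∑ i, α i

/-- The bilinear Hörmander symbol class `BS^m_{ρ,δ}(ℝⁿ)`. -/
structure IsBilinearSymbol {n : ℕ} (m ρ δ : ℝ) (σ : Rn n × Rn n × Rn n → ℂ) : Prop where
  smooth : ContDiff ℝ ((⊤ : ℕ∞) : WithTop ℕ∞) σ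
  bound : ∀ α β γ : Fin n → ℕ, ∃ C : ℝ, 0 < C ∧ ∀ x ξ η : Rn n,
    ‖mixedDeriv α β γ σ (x, ξ, η)‖ ≤
      C * (1 + ‖ξ‖ + ‖η‖) ^
        (m + δ * (multiLen α : ℝ) - ρ * ((multiLen β : ℝ) + (multiLen γ : ℝ)))

/-- The Fourier transform `f̂(ξ) = ∫ e^{-i x·ξ} f(x) dx`. -/
def hat {n : ℕ} (f : Rn n → ℂ) (ξ : Rn n) : ℂ :=
  ∫ x : Rn n, Complex.exp (-Complex.I * ((inner ℝ x ξ : ℝ) : ℂ)) * f x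

/-- The bilinear pseudo-differential operator
`T_σ(f, g)(x) = (2π)^{-2n} ∫ e^{i x·(ξ+η)} σ(x, ξ, η) f̂(ξ) ĝ(η) dξ dη`. -/
def bilinearOp {n : ℕ} (σ : Rn n × Rn n × Rn n → ℂ) (f g : SchwartzMap (Rn n) ℂ)
    (x : Rn n) : ℂ :=
  (1 / (2 * (Real.pi : ℂ)) ^ (2 * n)) *
    ∫ p : Rn n × Rn n,
      Complex.exp (Complex.I * ((inner ℝ x (p.1 + p.2) : ℝ) : ℂ)) *
        σ (x, p.1, p.2) * hat f p.1 * hat g p.2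

/-- The closed cube, with sides parallel to the axes, with lower corner `a` and side `l`. -/
def cube {n : ℕ} (a : Rn n) (l : ℝ) : Set (Rn n) := {x | ∀ i, a i ≤ x i ∧ x i ≤ a i + l}

/-- `sup_Q |Q|⁻¹ ∫_Q |f - f_Q|`, over all cubes `Q` of positive side; meaningful for locally
integrable `f`. -/
def bmoNorm {n : ℕ} (f : Rn n → ℂ) : ℝ≥0∞ :=
  ⨆ (a : Rn n) (l : ℝ) (_ : 0 < l),
    (volume (cube a l))⁻¹ * ∫⁻ x in cube a l, ‖f x - ⨍ y in cube a l, f y‖ₑ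

/-- Membership in `BMO(ℝⁿ)`. -/
structure MemBMO {n : ℕ} (f : Rn n → ℂ) : Prop where
  locallyIntegrable : LocallyIntegrable f volume
  norm_lt_top : bmoNorm f < ∞

end BilinearPDO

end

open MeasureTheory
open scoped ENNReal NNReal

noncomputable section

namespace BilinearPDO

/-! ### Calculus of iterated directional derivatives and their bounds. -/

section DerivativeCalculus

variable {V W : Type*} [NormedAddCommGroup V] [NormedSpace ℝ V] [NormedAddCommGroup W]
  [NormedSpace ℝ W] {ι : Type*}

/-- Smoothness of a complex valued function. -/
abbrev Smooth (F : V → ℂ) : Prop := ContDiff ℝ ((⊤ : ℕ∞) : WithTop ℕ∞) F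

theorem Smooth.differentiable {F : V → ℂ} (hF : Smooth F) : Differentiable ℝ F :=
  ContDiff.differentiable hF (by simp)

theorem Smooth.dirDeriv {F : V → ℂ} (hF : Smooth F) (v : V) : Smooth (dirDeriv v F) := by
  have : Smooth (fun p => fderiv ℝ F p v) :=
    (ContDiff.fderiv_right (m := ((⊤ : ℕ∞) : WithTop ℕ∞)) hF (by simp)).clm_apply contDiff_const
  exact this

theorem dirDeriv_comm {F : V → ℂ} (hF : Smooth F) (u v : V) :
    dirDeriv u (dirDeriv v F) = dirDeriv v (dirDeriv u F) := by
  have hd : Differentiable ℝ (fderiv ℝ F) :=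
    (ContDiff.fderiv_right (m := 1) hF (by norm_num; exact WithTop.coe_le_coe.2 (by exact le_top))).differentiable (by simp)
  have h : ∀ a b : V, ∀ p, dirDeriv a (dirDeriv b F) p = fderiv ℝ (fderiv ℝ F) p a b := by
    intro a b p
    change fderiv ℝ (fun q => fderiv ℝ F q b) p a = _
    rw [fderiv_clm_apply (hd p) (differentiableAt_const b)]
    simp
  funext p
  rw [h, h]
  exact (ContDiffAt.isSymmSndFDerivAt (n := ((⊤ : ℕ∞) : WithTop ℕ∞)) hF.contDiffAt
    (by simp; exact WithTop.coe_le_coe.2 (by exact le_top))) u v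

theorem dirDeriv_add {F G : V → ℂ} (hF : Differentiable ℝ F) (hG : Differentiable ℝ G) (v : V) :
    dirDeriv v (fun p => F p + G p) = fun p => dirDeriv v F p + dirDeriv v G p := by
  funext p
  simp only [dirDeriv]
  rw [fderiv_fun_add (hF p) (hG p)]
  rfl

theorem dirDeriv_mul {F G : V → ℂ} (hF : Differentiable ℝ F) (hG : Differentiable ℝ G) (v : V) :
    dirDeriv v (fun p => F p * G p) = fun p => dirDeriv v F p * G p + F p * dirDeriv v G p := by
  funext p
  simp only [dirDeriv]
  rw [fderiv_fun_mul (hF p) (hG p)]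
  simp
  ring

theorem dirDeriv_const_mul {F : V → ℂ} (hF : Differentiable ℝ F) (c : ℂ) (v : V) :
    dirDeriv v (fun p => c * F p) = fun p => c * dirDeriv v F p := by
  funext p
  simp only [dirDeriv]
  rw [fderiv_const_mul (hF p)]
  simp

theorem dirDeriv_smul_left (c : ℝ) (v : V) (F : V → ℂ) :
    dirDeriv (c • v) F = fun p => (c : ℂ) * dirDeriv v F p := by
  funext p
  simp [dirDeriv]

theorem dirDeriv_comp_clm {F : W → ℂ} (hF : Differentiable ℝ F) (L : V →L[ℝ] W) (v : V) :
    dirDeriv v (fun p => F (L p)) = fun p => dirDeriv (L v) F (L p) := by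
  funext p
  have := ((hF (L p)).hasFDerivAt.comp p L.hasFDerivAt).fderiv
  simp only [dirDeriv]
  change fderiv ℝ (F ∘ L) p v = _
  rw [this]
  rfl

theorem dirDeriv_eq_zero_of_eventuallyEq {F : V → ℂ} {p : V} (h : F =ᶠ[nhds p] 0) (v : V) :
    dirDeriv v F p = 0 := by
  simp only [dirDeriv]
  rw [h.fderiv_eq]
  simp

/-- All iterated derivatives of `F` at `p` along at most `k` of the directions `v d` are bounded
by `A`. -/
def DerivBound (v : ι → V) : ℕ → ℝ → (V → ℂ) → V → Prop
  | 0, A, F, p => ‖F p‖ ≤ A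
  | k + 1, A, F, p => ‖F p‖ ≤ A ∧ ∀ d, DerivBound v k A (dirDeriv (v d) F) p

variable {v : ι → V} {k : ℕ} {A B : ℝ} {F G : V → ℂ} {p : V}

theorem DerivBound.norm_le (h : DerivBound v k A F p) : ‖F p‖ ≤ A := by
  cases k with
  | zero => exact h
  | succ k => exact h.1

theorem DerivBound.mono (h : DerivBound v k A F p) (hAB : A ≤ B) : DerivBound v k B F p := by
  induction k generalizing F with
  | zero => exact le_trans h hAB
  | succ k ih => exact ⟨h.1.trans hAB, fun d => ih (h.2 d)⟩

theorem DerivBound.of_succ (h : DerivBound v (k + 1) A F p) : DerivBound v k A F p := by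
  induction k generalizing F with
  | zero => exact h.1
  | succ k ih => exact ⟨h.1, fun d => ih (h.2 d)⟩

theorem DerivBound.of_le {l : ℕ} (h : DerivBound v l A F p) (hkl : k ≤ l) :
    DerivBound v k A F p := by
  induction hkl with
  | refl => exact h
  | step _ ih => exact ih h.of_succ

theorem DerivBound.add (hF : Smooth F) (hG : Smooth G) (h : DerivBound v k A F p)
    (h' : DerivBound v k B G p) : DerivBound v k (A + B) (fun q => F q + G q) p := by
  induction k generalizing F G with
  | zero => exact (norm_add_le _ _).trans (add_le_add h h')
  | succ k ih =>
    refine ⟨(norm_add_le _ _).trans (add_le_add h.1 h'.1), fun d => ?_⟩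
    rw [dirDeriv_add hF.differentiable hG.differentiable]
    exact ih (hF.dirDeriv _) (hG.dirDeriv _) (h.2 d) (h'.2 d)

theorem DerivBound.const_mul (hF : Smooth F) (h : DerivBound v k A F p) (c : ℂ) :
    DerivBound v k (‖c‖ * A) (fun q => c * F q) p := by
  have key : ∀ q : ℂ, ‖q‖ ≤ A → ‖c * q‖ ≤ ‖c‖ * A := fun q hq => by
    rw [norm_mul]; gcongr
  induction k generalizing F with
  | zero => exact key _ h
  | succ k ih =>
    refine ⟨key _ h.1, fun d => ?_⟩
    rw [dirDeriv_const_mul hF.differentiable]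
    exact ih (hF.dirDeriv _) (h.2 d)

theorem DerivBound.zero_fun (hA : 0 ≤ A) : DerivBound v k A (fun _ => (0 : ℂ)) p := by
  induction k with
  | zero => simpa [DerivBound] using hA
  | succ k ih =>
    refine ⟨by simpa using hA, fun d => ?_⟩
    have : dirDeriv (v d) (fun _ : V => (0 : ℂ)) = fun _ => 0 := by
      funext q; simp [dirDeriv]
    rw [this]
    exact ih

theorem DerivBound.sum {κ : Type*} (S : Finset κ) {F : κ → V → ℂ} {A : κ → ℝ}
    (hF : ∀ i ∈ S, Smooth (F i)) (h : ∀ i ∈ S, DerivBound v k (A i) (F i) p) :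
    DerivBound v k (∑ i ∈ S, A i) (fun q => ∑ i ∈ S, F i q) p := by
  classical
  induction S using Finset.induction_on with
  | empty => simpa using DerivBound.zero_fun le_rfl
  | insert a S ha ih =>
    simp only [Finset.sum_insert ha]
    refine DerivBound.add (hF a (by simp)) ?_ (h a (by simp))
      (ih (fun i hi => hF i (by simp [hi])) (fun i hi => h i (by simp [hi])))
    exact ContDiff.sum fun i hi => hF i (by simp [hi])

/-- Leibniz rule: each differentiation turns a product into two products satisfying bounds of one
order less, so k of them produce at most 2^k terms. -/
theorem DerivBound.mul (hF : Smooth F) (hG : Smooth G) (h : DerivBound v k A F p)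
    (h' : DerivBound v k B G p) : DerivBound v k (2 ^ k * (A * B)) (fun q => F q * G q) p := by
  have hA : 0 ≤ A := (norm_nonneg _).trans h.norm_le
  have hB : 0 ≤ B := (norm_nonneg _).trans h'.norm_le
  induction k generalizing F G with
  | zero =>
    have h1 : ‖F p‖ ≤ A := h
    have h2 : ‖G p‖ ≤ B := h'
    change ‖F p * G p‖ ≤ _
    rw [norm_mul, pow_zero, one_mul]
    gcongr
  | succ k ih =>
    refine ⟨?_, fun d => ?_⟩
    · rw [norm_mul]
      calc ‖F p‖ * ‖G p‖ ≤ A * B := mul_le_mul h.1 h'.1 (norm_nonneg _) hA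
        _ ≤ 2 ^ (k + 1) * (A * B) :=
          le_mul_of_one_le_left (mul_nonneg hA hB) (one_le_pow₀ (by norm_num))
    · rw [dirDeriv_mul hF.differentiable hG.differentiable]
      have e : (2 : ℝ) ^ (k + 1) * (A * B) = 2 ^ k * (A * B) + 2 ^ k * (A * B) := by ring
      rw [e]
      exact DerivBound.add ((hF.dirDeriv _).mul hG) (hF.mul (hG.dirDeriv _))
        (ih (hF.dirDeriv _) hG (h.2 d) h'.of_succ) (ih hF (hG.dirDeriv _) h.of_succ (h'.2 d))

/-- Derivatives depend only on the germ, so symbol estimates need checking only near the frequency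
support. -/
theorem DerivBound.of_eventuallyEq_zero (h : F =ᶠ[nhds p] 0) : DerivBound v k 0 F p := by
  induction k generalizing F with
  | zero => change ‖F p‖ ≤ 0; rw [h.self_of_nhds]; simp
  | succ k ih =>
    refine ⟨by rw [h.self_of_nhds]; simp, fun d => ih ?_⟩
    filter_upwards [h.eventuallyEq_nhds] with q hq
    exact dirDeriv_eq_zero_of_eventuallyEq hq _

theorem DerivBound.comp_clm {F : W → ℂ} (hF : Smooth F) (L : V →L[ℝ] W)
    (h : DerivBound (fun d => L (v d)) k A F (L p)) : DerivBound v k A (fun q => F (L q)) p := by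
  induction k generalizing F with
  | zero => exact h
  | succ k ih =>
    refine ⟨h.1, fun d => ?_⟩
    rw [dirDeriv_comp_clm hF.differentiable]
    exact ih (hF.dirDeriv _) (h.2 d)

theorem DerivBound.smul_dir (hF : Smooth F) (c : ι → ℝ) (hc : ∀ d, |c d| ≤ 1)
    (h : DerivBound v k A F p) : DerivBound (fun d => c d • v d) k A F p := by
  induction k generalizing F with
  | zero => exact h
  | succ k ih =>
    refine ⟨h.1, fun d => ?_⟩
    have hA : 0 ≤ A := (norm_nonneg _).trans h.1
    rw [dirDeriv_smul_left]
    refine ((ih (hF.dirDeriv _) (h.2 d)).const_mul (hF.dirDeriv _) _).mono ?_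
    rw [Complex.norm_real, Real.norm_eq_abs]
    exact mul_le_of_le_one_left hA (hc d)

theorem exists_derivBound_of_hasCompactSupport [Finite ι] (v : ι → V) (k : ℕ) (hF : Smooth F)
    (hc : HasCompactSupport F) : ∃ A, ∀ p, DerivBound v k A F p := by
  cases nonempty_fintype ι
  have hb : ∀ {F : V → ℂ}, Smooth F → HasCompactSupport F → ∃ A, ∀ p, ‖F p‖ ≤ A := by
    intro F hF hc
    exact hF.continuous.bounded_above_of_compact_support hc
  induction k generalizing F with
  | zero => exact hb hF hc
  | succ k ih =>
    have hd : ∀ d, HasCompactSupport (dirDeriv (v d) F) := fun d => by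
      refine (hc.fderiv (𝕜 := ℝ)).mono fun q hq => ?_
      simp only [Function.mem_support, dirDeriv] at hq ⊢
      intro h0
      rw [h0] at hq
      simp at hq
    obtain ⟨A, hA⟩ := hb hF hc
    choose B hB using fun d => ih (hF.dirDeriv (v d)) (hd d)
    refine ⟨|A| + ∑ d, |B d|, fun p => ⟨?_, fun d => (hB d p).mono ?_⟩⟩
    · have : 0 ≤ ∑ d, |B d| := Finset.sum_nonneg fun _ _ => abs_nonneg _
      linarith [hA p, le_abs_self A]
    · have := Finset.single_le_sum (f := fun d => |B d|) (fun _ _ => abs_nonneg _)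
        (Finset.mem_univ d)
      linarith [le_abs_self (B d), abs_nonneg A]

/-! ### Multi-index derivatives -/

variable {n : ℕ}

theorem Smooth.iterate_dirDeriv {F : V → ℂ} (hF : Smooth F) (v : V) (m : ℕ) :
    Smooth ((BilinearPDO.dirDeriv v)^[m] F) := by
  induction m generalizing F with
  | zero => exact hF
  | succ m ih => exact ih (hF.dirDeriv v)

theorem smooth_foldr (v : Fin n → V) (α : Fin n → ℕ) (L : List (Fin n)) (hF : Smooth F) :
    Smooth (L.foldr (fun i G => (dirDeriv (v i))^[α i] G) F) := by
  induction L with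
  | nil => exact hF
  | cons a L ih => exact ih.iterate_dirDeriv _ _

theorem Smooth.multiDeriv (hF : Smooth F) (v : Fin n → V) (α : Fin n → ℕ) :
    Smooth (multiDeriv v α F) :=
  smooth_foldr v α _ hF

theorem dirDeriv_iterate_comm (hF : Smooth F) (u v : V) (m : ℕ) :
    dirDeriv u ((dirDeriv v)^[m] F) = (dirDeriv v)^[m] (dirDeriv u F) := by
  induction m generalizing F with
  | zero => rfl
  | succ m ih =>
    rw [Function.iterate_succ_apply, Function.iterate_succ_apply, ih (hF.dirDeriv v),
      dirDeriv_comm hF]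

theorem dirDeriv_foldr_comm (v : Fin n → V) (α : Fin n → ℕ) (L : List (Fin n)) (hF : Smooth F)
    (u : V) : dirDeriv u (L.foldr (fun i G => (dirDeriv (v i))^[α i] G) F) =
      L.foldr (fun i G => (dirDeriv (v i))^[α i] G) (dirDeriv u F) := by
  induction L with
  | nil => rfl
  | cons a L ih =>
    simp only [List.foldr_cons]
    rw [dirDeriv_iterate_comm (smooth_foldr v α L hF), ih]

theorem dirDeriv_multiDeriv_comm (hF : Smooth F) (v : Fin n → V) (α : Fin n → ℕ) (u : V) :
    dirDeriv u (multiDeriv v α F) = multiDeriv v α (dirDeriv u F) :=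
  dirDeriv_foldr_comm v α _ hF u

/-- In a duplicate-free list the index j occurs at most once; the extra derivative appears there and
is commuted to the front. This links the class's ordered multi-index derivatives to the order-free
recursion of `DerivBound`. -/
theorem foldr_dirDeriv_single (v : Fin n → V) (α : Fin n → ℕ) (j : Fin n) (L : List (Fin n))
    (hL : L.Nodup) (hF : Smooth F) :
    L.foldr (fun i G => (dirDeriv (v i))^[(α + Pi.single j 1 : Fin n → ℕ) i] G) F =
      if j ∈ L then dirDeriv (v j) (L.foldr (fun i G => (dirDeriv (v i))^[α i] G) F)
      else L.foldr (fun i G => (dirDeriv (v i))^[α i] G) F := by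
  induction L with
  | nil => simp
  | cons a L ih =>
    obtain ⟨haL, hL⟩ := List.nodup_cons.1 hL
    simp only [List.foldr_cons]
    rw [ih hL]
    by_cases hja : j = a
    · subst hja
      simp only [haL, if_false, List.mem_cons, true_or, if_true, Pi.add_apply, Pi.single_eq_same]
      rw [Function.iterate_succ_apply']
    · have : (α + Pi.single j 1 : Fin n → ℕ) a = α a := by
        simp [Pi.single_eq_of_ne (Ne.symm hja)]
      rw [this]
      by_cases hjL : j ∈ L
      · simp only [hjL, if_true, List.mem_cons, or_true]
        rw [dirDeriv_iterate_comm (smooth_foldr v α L hF)]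
      · simp [hjL, hja]

theorem dirDeriv_multiDeriv (hF : Smooth F) (v : Fin n → V) (α : Fin n → ℕ) (j : Fin n) :
    dirDeriv (v j) (multiDeriv v α F) = multiDeriv v (α + Pi.single j 1) F := by
  have := foldr_dirDeriv_single v α j (List.finRange n) (List.nodup_finRange n) hF
  rw [if_pos (List.mem_finRange j)] at this
  exact this.symm

theorem multiLen_add_single (α : Fin n → ℕ) (j : Fin n) :
    multiLen (α + Pi.single j 1) = multiLen α + 1 := by
  simp [multiLen, Finset.sum_add_distrib]

end DerivativeCalculus

/-! ### Dyadic decomposition of the symbol into amplitudes. -/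

section Symbols

variable {n : ℕ}

/-- The coordinate directions of `ℝⁿ × ℝⁿ × ℝⁿ`, scaled by `c₁` in the first factor and by `c₂` in
the other two. -/
def scaledDir (c₁ c₂ : ℝ) : Fin n ⊕ Fin n ⊕ Fin n → Rn n × Rn n × Rn n
  | Sum.inl j => c₁ • (stdVec j, 0, 0)
  | Sum.inr (Sum.inl j) => c₂ • (0, stdVec j, 0)
  | Sum.inr (Sum.inr j) => c₂ • (0, 0, stdVec j)

/-- Smooth amplitudes supported in `‖ξ‖, ‖η‖ ≤ B`, whose derivatives up to order `k`, normalised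
by the scale `s⁻¹` in `x` and `s` in `ξ, η`, are bounded by `A`. -/
structure Amplitude (s B : ℝ) (k : ℕ) (A : ℝ) (a : Rn n × Rn n × Rn n → ℂ) : Prop where
  smooth : Smooth a
  support : ∀ x ξ η, a (x, ξ, η) ≠ 0 → ‖ξ‖ ≤ B ∧ ‖η‖ ≤ B
  bound : ∀ q, DerivBound (scaledDir s⁻¹ s) k A a q

theorem mixedDeriv_x {σ : Rn n × Rn n × Rn n → ℂ} (hσ : Smooth σ) (α β γ : Fin n → ℕ)
    (j : Fin n) : dirDeriv (stdVec j, 0, 0) (mixedDeriv α β γ σ) =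
      mixedDeriv (α + Pi.single j 1) β γ σ :=
  dirDeriv_multiDeriv ((hσ.multiDeriv _ _).multiDeriv _ _) (fun i => (stdVec i, 0, 0)) α j

theorem mixedDeriv_xi {σ : Rn n × Rn n × Rn n → ℂ} (hσ : Smooth σ) (α β γ : Fin n → ℕ)
    (j : Fin n) : dirDeriv (0, stdVec j, 0) (mixedDeriv α β γ σ) =
      mixedDeriv α (β + Pi.single j 1) γ σ := by
  unfold mixedDeriv
  rw [dirDeriv_multiDeriv_comm ((hσ.multiDeriv _ _).multiDeriv _ _),
    ← dirDeriv_multiDeriv (hσ.multiDeriv _ _)]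

theorem mixedDeriv_eta {σ : Rn n × Rn n × Rn n → ℂ} (hσ : Smooth σ) (α β γ : Fin n → ℕ)
    (j : Fin n) : dirDeriv (0, 0, stdVec j) (mixedDeriv α β γ σ) =
      mixedDeriv α β (γ + Pi.single j 1) σ := by
  unfold mixedDeriv
  rw [dirDeriv_multiDeriv_comm ((hσ.multiDeriv _ _).multiDeriv _ _),
    dirDeriv_multiDeriv_comm (hσ.multiDeriv _ _), ← dirDeriv_multiDeriv hσ]

theorem Smooth.mixedDeriv {σ : Rn n × Rn n × Rn n → ℂ} (hσ : Smooth σ) (α β γ : Fin n → ℕ) :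
    Smooth (mixedDeriv α β γ σ) :=
  ((hσ.multiDeriv _ _).multiDeriv _ _).multiDeriv _ _

/-- A scaled coordinate derivative raises one multi-index entry and supplies the matching power of
c₁ or c₂, so the family of normalised mixed derivatives is closed under the recursion until the
total order N is used up. -/
theorem derivBound_mixedDeriv {σ : Rn n × Rn n × Rn n → ℂ} (hσ : Smooth σ) {c₁ c₂ A : ℝ} {N : ℕ}
    {q : Rn n × Rn n × Rn n}
    (h : ∀ α β γ : Fin n → ℕ, multiLen α + multiLen β + multiLen γ ≤ N →
      ‖((c₁ ^ multiLen α * c₂ ^ (multiLen β + multiLen γ) : ℝ) : ℂ) * mixedDeriv α β γ σ q‖ ≤ A)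
    (k : ℕ) (α β γ : Fin n → ℕ) (hk : multiLen α + multiLen β + multiLen γ + k ≤ N) :
    DerivBound (scaledDir c₁ c₂) k A (fun p =>
      ((c₁ ^ multiLen α * c₂ ^ (multiLen β + multiLen γ) : ℝ) : ℂ) * mixedDeriv α β γ σ p) q := by
  induction k generalizing α β γ with
  | zero => exact h α β γ hk
  | succ k ih =>
    refine ⟨h α β γ (by omega), fun d => ?_⟩
    rw [dirDeriv_const_mul (hσ.mixedDeriv α β γ).differentiable]
    rcases d with j | j | j
    · convert ih (α + Pi.single j 1) β γ (by rw [multiLen_add_single]; omega) using 1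
      funext p
      simp only [scaledDir]
      rw [dirDeriv_smul_left, mixedDeriv_x hσ, multiLen_add_single]
      push_cast
      ring
    · convert ih α (β + Pi.single j 1) γ (by rw [multiLen_add_single]; omega) using 1
      funext p
      simp only [scaledDir]
      rw [dirDeriv_smul_left, mixedDeriv_xi hσ, multiLen_add_single]
      push_cast
      ring
    · convert ih α β (γ + Pi.single j 1) (by rw [multiLen_add_single]; omega) using 1
      funext p
      simp only [scaledDir]
      rw [dirDeriv_smul_left, mixedDeriv_eta hσ, multiLen_add_single]
      push_cast
      ring

theorem multiDeriv_zero {V : Type*} [NormedAddCommGroup V] [NormedSpace ℝ V] (v : Fin n → V)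
    (F : V → ℂ) : multiDeriv v 0 F = F := by
  unfold multiDeriv
  induction List.finRange n with
  | nil => rfl
  | cons a L ih => simp

theorem IsBilinearSymbol.exists_uniform_bound {m ρ : ℝ} {σ : Rn n × Rn n × Rn n → ℂ}
    (hσ : IsBilinearSymbol m ρ ρ σ) (N : ℕ) : ∃ C : ℝ, 0 ≤ C ∧ ∀ α β γ : Fin n → ℕ,
      multiLen α + multiLen β + multiLen γ ≤ N → ∀ x ξ η : Rn n,
        ‖mixedDeriv α β γ σ (x, ξ, η)‖ ≤ C * (1 + ‖ξ‖ + ‖η‖) ^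
          (m + ρ * (multiLen α : ℝ) - ρ * ((multiLen β : ℝ) + (multiLen γ : ℝ))) := by
  choose C hC0 hC using hσ.bound
  have hfin : (Set.Iic (fun _ : Fin n => N)).Finite := Set.finite_Iic _
  obtain ⟨D, hD⟩ := (((hfin.prod (hfin.prod hfin)).image
    (fun t : (Fin n → ℕ) × (Fin n → ℕ) × (Fin n → ℕ) => C t.1 t.2.1 t.2.2))).bddAbove
  refine ⟨|D|, abs_nonneg _, fun α β γ h x ξ η => (hC α β γ x ξ η).trans ?_⟩
  have hle : ∀ δ : Fin n → ℕ, multiLen δ ≤ N → δ ∈ Set.Iic (fun _ : Fin n => N) := by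
    intro δ hδ i
    exact (Finset.single_le_sum (f := δ) (fun _ _ => Nat.zero_le _) (Finset.mem_univ i)).trans hδ
  gcongr
  refine le_trans (hD ⟨(α, β, γ), ⟨hle α (by omega), hle β (by omega), hle γ (by omega)⟩, rfl⟩)
    (le_abs_self D)

/-- Rescaling of the frequency variables by `2π`. -/
def freqScale : (Rn n × Rn n × Rn n) →L[ℝ] (Rn n × Rn n × Rn n) :=
  (ContinuousLinearMap.fst ℝ _ _).prod ((2 * Real.pi) • ContinuousLinearMap.snd ℝ _ _)

theorem freqScale_apply (q : Rn n × Rn n × Rn n) :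
    freqScale q = (q.1, (2 * Real.pi) • q.2.1, (2 * Real.pi) • q.2.2) := rfl

theorem freqScale_scaledDir (c₁ c₂ : ℝ) (d : Fin n ⊕ Fin n ⊕ Fin n) :
    freqScale (scaledDir c₁ c₂ d) = scaledDir c₁ (2 * Real.pi * c₂) d := by
  rcases d with j | j | j <;> simp [freqScale_apply, scaledDir, smul_smul]

/-- A smooth bump function on frequency space. -/
def freqBump (n : ℕ) : ContDiffBump (0 : Rn n × Rn n) := ⟨1, 2, by norm_num, by norm_num⟩

/-- The dilated frequency cutoff, equal to `1` for `‖(ξ, η)‖ ≤ 2 ^ j`. -/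
def freqCutoff (j : ℕ) (q : Rn n × Rn n × Rn n) : ℂ :=
  ((freqBump n (((2 : ℝ) ^ j)⁻¹ • q.2) : ℝ) : ℂ)

theorem freqCutoff_eq_one {j : ℕ} {q : Rn n × Rn n × Rn n} (h : ‖q.2‖ ≤ 2 ^ j) :
    freqCutoff j q = 1 := by
  unfold freqCutoff
  rw [(freqBump n).one_of_mem_closedBall, Complex.ofReal_one]
  rw [mem_closedBall_zero_iff, norm_smul, norm_inv, norm_pow, Real.norm_ofNat]
  change _ ≤ (1 : ℝ)
  rw [inv_mul_le_one₀ (by positivity)]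
  exact h

theorem freqCutoff_eq_zero {j : ℕ} {q : Rn n × Rn n × Rn n} (h : 2 ^ (j + 1) ≤ ‖q.2‖) :
    freqCutoff j q = 0 := by
  unfold freqCutoff
  rw [(freqBump n).zero_of_le_dist, Complex.ofReal_zero]
  rw [dist_zero_right, norm_smul, norm_inv, norm_pow, Real.norm_ofNat]
  change (2 : ℝ) ≤ _
  rw [inv_mul_eq_div, le_div_iff₀ (by positivity)]
  rw [pow_succ] at h
  linarith

theorem norm_freqCutoff_le (j : ℕ) (q : Rn n × Rn n × Rn n) : ‖freqCutoff j q‖ ≤ 1 := by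
  unfold freqCutoff
  rw [Complex.norm_real, Real.norm_of_nonneg (freqBump n).nonneg]
  exact (freqBump n).le_one

theorem smooth_freqBump : Smooth (fun p : Rn n × Rn n => ((freqBump n p : ℝ) : ℂ)) :=
  Complex.ofRealCLM.contDiff.comp (freqBump n).contDiff

/-- The dilation of frequency space by `2 ^ (-j)`. -/
def freqDilation (n j : ℕ) : (Rn n × Rn n × Rn n) →L[ℝ] (Rn n × Rn n) :=
  (((2 : ℝ) ^ j)⁻¹) • ContinuousLinearMap.snd ℝ _ _

theorem smooth_freqCutoff (j : ℕ) : Smooth (freqCutoff (n := n) j) :=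
  smooth_freqBump.comp (freqDilation n j).contDiff

/-- Uniform in j because a derivative at scale s of a bump dilated by 2^j costs s/2^j; the factor
s⁻¹ is harmless because the cutoff does not depend on x. The slack 2 in s ≤ 2 · 2^j is there because
`dyadicCutoff (j + 1)` contains `freqCutoff j` while s may be as large as 2^(j+1). -/
theorem exists_derivBound_freqCutoff (k : ℕ) : ∃ A : ℝ, 0 ≤ A ∧ ∀ (j : ℕ) (s : ℝ), 0 ≤ s →
    s ≤ 2 * 2 ^ j → ∀ q : Rn n × Rn n × Rn n,
      DerivBound (scaledDir s⁻¹ s) k A (freqCutoff j) q := by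
  have hcs : HasCompactSupport (fun p : Rn n × Rn n => ((freqBump n p : ℝ) : ℂ)) :=
    (freqBump n).hasCompactSupport.comp_left (g := fun t : ℝ => (t : ℂ)) (by simp)
  obtain ⟨A, hA⟩ := exists_derivBound_of_hasCompactSupport
    (fun d : Fin n ⊕ Fin n ⊕ Fin n => (2 : ℝ) • (scaledDir 1 1 d).2) k smooth_freqBump hcs
  refine ⟨A, (norm_nonneg _).trans (hA 0).norm_le, fun j s hs hsj q => ?_⟩
  have h := (hA (freqDilation n j q)).smul_dir smooth_freqBump
    (fun d => s / (2 * 2 ^ j)) (fun d => by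
      rw [abs_of_nonneg (by positivity)]
      exact div_le_one_of_le₀ hsj (by positivity))
  refine DerivBound.comp_clm smooth_freqBump (freqDilation n j) (v := scaledDir s⁻¹ s) ?_
  convert h using 2 with d
  rcases d with i | i | i <;>
    simp [freqDilation, scaledDir, smul_smul] <;> congr 1 <;> field_simp

/-- A dyadic partition of unity in the frequency variables. -/
def dyadicCutoff : ℕ → Rn n × Rn n × Rn n → ℂ
  | 0 => freqCutoff 0
  | j + 1 => fun q => freqCutoff (j + 1) q + (-1) * freqCutoff j q

theorem sum_dyadicCutoff (J : ℕ) (q : Rn n × Rn n × Rn n) :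
    ∑ j ∈ Finset.range (J + 1), dyadicCutoff j q = freqCutoff J q := by
  induction J with
  | zero => simp [dyadicCutoff]
  | succ J ih => rw [Finset.sum_range_succ, ih]; simp [dyadicCutoff]

theorem smooth_dyadicCutoff (j : ℕ) : Smooth (dyadicCutoff (n := n) j) := by
  cases j with
  | zero => exact smooth_freqCutoff 0
  | succ j => exact (smooth_freqCutoff _).add (contDiff_const.mul (smooth_freqCutoff _))

theorem dyadicCutoff_eq_zero {j : ℕ} {q : Rn n × Rn n × Rn n} (h : 2 ^ (j + 1) ≤ ‖q.2‖) :
    dyadicCutoff j q = 0 := by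
  cases j with
  | zero => exact freqCutoff_eq_zero h
  | succ j =>
    have : (2 : ℝ) ^ (j + 1) ≤ 2 ^ (j + 1 + 1) := pow_le_pow_right₀ (by norm_num) (by omega)
    simp [dyadicCutoff, freqCutoff_eq_zero h, freqCutoff_eq_zero (this.trans h)]

theorem dyadicCutoff_succ_eq_zero {j : ℕ} {q : Rn n × Rn n × Rn n} (h : ‖q.2‖ ≤ 2 ^ j) :
    dyadicCutoff (j + 1) q = 0 := by
  have : (2 : ℝ) ^ j ≤ 2 ^ (j + 1) := pow_le_pow_right₀ (by norm_num) (by omega)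
  simp [dyadicCutoff, freqCutoff_eq_one h, freqCutoff_eq_one (h.trans this)]

theorem exists_derivBound_dyadicCutoff (k : ℕ) : ∃ A : ℝ, 0 ≤ A ∧ ∀ (j : ℕ) (s : ℝ), 0 ≤ s →
    s ≤ 2 ^ j → ∀ q : Rn n × Rn n × Rn n,
      DerivBound (scaledDir s⁻¹ s) k A (dyadicCutoff j) q := by
  obtain ⟨A, hA0, hA⟩ := exists_derivBound_freqCutoff (n := n) k
  refine ⟨A + A, by positivity, fun j s hs hsj q => ?_⟩
  have hpos : (0 : ℝ) < 2 ^ j := by positivity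
  cases j with
  | zero => exact (hA 0 s hs (by linarith) q).mono (by linarith)
  | succ j =>
    refine DerivBound.add (smooth_freqCutoff _) (contDiff_const.mul (smooth_freqCutoff _))
      (hA _ s hs (by linarith) q) ?_
    have := (hA j s hs (by rw [pow_succ] at hsj; linarith) q).const_mul (smooth_freqCutoff j) (-1)
    simpa using this

/-- The dyadic pieces of a symbol, with frequencies rescaled by `2π`. -/
def dyadicPiece (σ : Rn n × Rn n × Rn n → ℂ) (j : ℕ) (q : Rn n × Rn n × Rn n) : ℂ :=
  σ (freqScale q) * dyadicCutoff j q

/-- With t = uR, the powers of R^ρ from the symbol estimate cancel the normalising factors exactly;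
this is where δ = ρ enters. What remains is R^m times powers of 2π and of u ∈ [1, 32]. -/
theorem rpow_scaling {R t m ρ : ℝ} {N a b : ℕ} (hR : 1 ≤ R) (hRt : R ≤ t) (htR : t ≤ 32 * R)
    (hρ0 : 0 ≤ ρ) (hab : a + b ≤ N) :
    ((R ^ ρ)⁻¹) ^ a * (2 * Real.pi * R ^ ρ) ^ b * t ^ (m + ρ * a - ρ * b) ≤
      (2 * Real.pi) ^ N * 32 ^ (|m| + ρ * N) * R ^ m := by
  have hR0 : 0 < R := by linarith
  obtain ⟨u, hu⟩ : ∃ u, t = u * R := ⟨t / R, by field_simp⟩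
  subst hu
  have hu1 : 1 ≤ u := by
    by_contra h
    nlinarith
  have hu2 : u ≤ 32 := le_of_mul_le_mul_right htR hR0
  have hu0 : 0 < u := by linarith
  rw [Real.mul_rpow hu0.le hR0.le]
  have e1 : R ^ (m + ρ * a - ρ * b) = R ^ m * (R ^ ρ) ^ a * ((R ^ ρ) ^ b)⁻¹ := by
    rw [Real.rpow_sub hR0, Real.rpow_add hR0, Real.rpow_mul hR0.le, Real.rpow_mul hR0.le,
      Real.rpow_natCast, Real.rpow_natCast, div_eq_mul_inv]
  have hs : 0 < R ^ ρ := Real.rpow_pos_of_pos hR0 _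
  have e2 : ((R ^ ρ)⁻¹) ^ a * (2 * Real.pi * R ^ ρ) ^ b *
      (u ^ (m + ρ * a - ρ * b) * R ^ (m + ρ * a - ρ * b)) =
      (2 * Real.pi) ^ b * u ^ (m + ρ * a - ρ * b) * R ^ m := by
    rw [e1, mul_pow, inv_pow]
    have h1 : (R ^ ρ) ^ a ≠ 0 := by positivity
    have h2 : (R ^ ρ) ^ b ≠ 0 := by positivity
    field_simp
  rw [e2]
  have hab' : (a : ℝ) + b ≤ N := by exact_mod_cast hab
  have hb0 : (0 : ℝ) ≤ b := by positivity
  have ha : (a : ℝ) ≤ N := by linarith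
  have hexp : m + ρ * a - ρ * b ≤ |m| + ρ * N := by
    have := mul_le_mul_of_nonneg_left ha hρ0
    have := mul_nonneg hρ0 hb0
    linarith [le_abs_self m]
  have hexp0 : 0 ≤ |m| + ρ * N := by positivity
  have hpi : 1 ≤ 2 * Real.pi := by linarith [Real.pi_gt_three]
  gcongr ?_ * ?_ * _
  · exact pow_le_pow_right₀ hpi (by omega)
  · calc u ^ (m + ρ * a - ρ * b) ≤ u ^ (|m| + ρ * N) := Real.rpow_le_rpow_of_exponent_le hu1 hexp
      _ ≤ 32 ^ (|m| + ρ * N) := Real.rpow_le_rpow hu0.le hu2 hexp0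

theorem smooth_dyadicPiece {σ : Rn n × Rn n × Rn n → ℂ} (hσ : Smooth σ) (j : ℕ) :
    Smooth (dyadicPiece σ j) :=
  ContDiff.mul (ContDiff.comp hσ freqScale.contDiff) (smooth_dyadicCutoff j)

theorem dyadicPiece_eventuallyEq_zero (σ : Rn n × Rn n × Rn n → ℂ) (j : ℕ)
    (q : Rn n × Rn n × Rn n)
    (h : ¬ ((2 : ℝ) ^ j ≤ 1 + ‖(freqScale q).2.1‖ + ‖(freqScale q).2.2‖ ∧
      1 + ‖(freqScale q).2.1‖ + ‖(freqScale q).2.2‖ ≤ 32 * 2 ^ j)) :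
    dyadicPiece σ j =ᶠ[nhds q] 0 := by
  have hpi := Real.pi_gt_three
  have hpi4 := Real.pi_lt_d2
  have ht : ∀ p : Rn n × Rn n × Rn n, 1 + ‖(freqScale p).2.1‖ + ‖(freqScale p).2.2‖ =
      1 + 2 * Real.pi * (‖p.2.1‖ + ‖p.2.2‖) := fun p => by
    simp only [freqScale_apply, norm_smul]
    rw [Real.norm_of_nonneg (by positivity)]
    ring
  have hcont : Continuous fun p : Rn n × Rn n × Rn n =>
      1 + ‖(freqScale p).2.1‖ + ‖(freqScale p).2.2‖ := by fun_prop
  have hR : (1 : ℝ) ≤ 2 ^ j := one_le_pow₀ (by norm_num)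
  rw [not_and_or, not_le, not_le] at h
  rcases h with h | h
  · filter_upwards [(isOpen_lt hcont continuous_const).mem_nhds h] with p hp
    have hp' : 1 + ‖(freqScale p).2.1‖ + ‖(freqScale p).2.2‖ < 2 ^ j := hp
    rw [ht] at hp'
    have h1 := norm_nonneg p.2.1
    have h2 := norm_nonneg p.2.2
    cases j with
    | zero => simp only [pow_zero] at hp'; nlinarith
    | succ j =>
      simp only [dyadicPiece, Pi.zero_apply]
      rw [dyadicCutoff_succ_eq_zero, mul_zero]
      rw [pow_succ] at hp'
      rw [Prod.norm_def, max_le_iff]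
      constructor <;> nlinarith
  · filter_upwards [(isOpen_lt continuous_const hcont).mem_nhds h] with p hp
    have hp' : 32 * 2 ^ j < 1 + ‖(freqScale p).2.1‖ + ‖(freqScale p).2.2‖ := hp
    rw [ht] at hp'
    have h1 := norm_nonneg p.2.1
    have h2 := norm_nonneg p.2.2
    simp only [dyadicPiece, Pi.zero_apply]
    rw [dyadicCutoff_eq_zero, mul_zero]
    by_contra hlt
    rw [not_le, Prod.norm_def, max_lt_iff, pow_succ] at hlt
    -- Where the cutoff is nonzero, 1 + 2π(‖ξ‖ + ‖η‖) ≤ 1 + 25.2 · 2^j, below 32 · 2^j; hence the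
    -- constant 32.
    have h3 : Real.pi * (‖p.2.1‖ + ‖p.2.2‖) ≤ 3.15 * (2 ^ j * 2 + 2 ^ j * 2) :=
      mul_le_mul hpi4.le (add_le_add hlt.1.le hlt.2.le) (by positivity) (by norm_num)
    linarith

/-- On the shell 1 + ‖ξ‖ + ‖η‖ ~ 2^j (after the 2π rescaling) the symbol has the required size by
`rpow_scaling`; off it the piece vanishes locally. The condition ρ ≤ 1 ensures that the cutoff,
smooth at scale 2^j, is also smooth at the finer scale 2^(jρ). -/
theorem IsBilinearSymbol.exists_amplitude {m ρ : ℝ} {σ : Rn n × Rn n × Rn n → ℂ}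
    (hσ : IsBilinearSymbol m ρ ρ σ) (hρ0 : 0 ≤ ρ) (hρ1 : ρ ≤ 1) (N : ℕ) :
    ∃ C : ℝ, 0 ≤ C ∧ ∀ j : ℕ, Amplitude (((2 : ℝ) ^ j) ^ ρ) (2 ^ (j + 1)) N
      (C * ((2 : ℝ) ^ j) ^ m) (dyadicPiece σ j) := by
  obtain ⟨C, hC0, hC⟩ := hσ.exists_uniform_bound N
  obtain ⟨D, hD0, hD⟩ := exists_derivBound_dyadicCutoff (n := n) N
  set E : ℝ := (2 * Real.pi) ^ N * 32 ^ (|m| + ρ * N) with hE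
  have hE0 : 0 ≤ E := by positivity
  refine ⟨2 ^ N * (C * E * D), by positivity, fun j => ⟨smooth_dyadicPiece hσ.smooth j, ?_, ?_⟩⟩
  · intro x ξ η h
    by_contra hcon
    apply h
    unfold dyadicPiece
    rw [dyadicCutoff_eq_zero, mul_zero]
    rw [not_and_or, not_le, not_le] at hcon
    simp only [Prod.norm_def, le_max_iff]
    exact hcon.imp le_of_lt le_of_lt
  · intro q
    have hR : (1 : ℝ) ≤ 2 ^ j := one_le_pow₀ (by norm_num)
    by_cases hq : ((2 : ℝ) ^ j ≤ 1 + ‖(freqScale q).2.1‖ + ‖(freqScale q).2.2‖ ∧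
      1 + ‖(freqScale q).2.1‖ + ‖(freqScale q).2.2‖ ≤ 32 * 2 ^ j)
    swap
    · exact (DerivBound.of_eventuallyEq_zero (dyadicPiece_eventuallyEq_zero σ j q hq)).mono
        (by positivity)
    have h1 : DerivBound (scaledDir (((2 : ℝ) ^ j) ^ ρ)⁻¹ (((2 : ℝ) ^ j) ^ ρ)) N
        (C * (E * ((2 : ℝ) ^ j) ^ m)) (fun p => σ (freqScale p)) q := by
      refine DerivBound.comp_clm hσ.smooth freqScale ?_
      simp only [freqScale_scaledDir]
      have := derivBound_mixedDeriv (N := N) hσ.smooth (c₁ := (((2 : ℝ) ^ j) ^ ρ)⁻¹)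
        (c₂ := 2 * Real.pi * (((2 : ℝ) ^ j) ^ ρ)) (q := freqScale q)
        (A := C * (E * ((2 : ℝ) ^ j) ^ m)) ?_ N 0 0 0 (by simp [multiLen])
      · simpa [mixedDeriv, multiDeriv_zero, multiLen] using this
      intro α β γ hl
      rw [norm_mul, Complex.norm_real, Real.norm_of_nonneg (by positivity)]
      have h2 := hC α β γ hl (freqScale q).1 (freqScale q).2.1 (freqScale q).2.2
      have h3 := rpow_scaling (m := m) (N := N) (a := multiLen α) (b := multiLen β + multiLen γ)
        hR hq.1 hq.2 hρ0 (by omega)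
      push_cast at h3
      calc _ ≤ _ := mul_le_mul_of_nonneg_left h2 (by positivity)
        _ = C * (((((2 : ℝ) ^ j) ^ ρ)⁻¹) ^ multiLen α *
            (2 * Real.pi * ((2 : ℝ) ^ j) ^ ρ) ^ (multiLen β + multiLen γ) *
            (1 + ‖(freqScale q).2.1‖ + ‖(freqScale q).2.2‖) ^
            (m + ρ * multiLen α - ρ * (multiLen β + multiLen γ))) := by ring
        _ ≤ _ := mul_le_mul_of_nonneg_left h3 hC0
    have h2 := hD j (((2 : ℝ) ^ j) ^ ρ) (by positivity)
      (by simpa using Real.rpow_le_rpow_of_exponent_le hR hρ1) q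
    refine (h1.mul (ContDiff.comp hσ.smooth freqScale.contDiff) (smooth_dyadicCutoff j) h2).mono
      (le_of_eq ?_)
    ring

end Symbols

/-! ### L² and pointwise bounds for bilinear multipliers with frozen symbol. -/

section BilinearMultipliers

open scoped FourierTransform

variable {n : ℕ}

theorem lintegral_mul_sq_le {α : Type*} [MeasurableSpace α] {μ : Measure α} {f g : α → ℝ≥0∞}
    (hf : AEMeasurable f μ) (hg : AEMeasurable g μ) :
    (∫⁻ x, f x * g x ∂μ) ^ 2 ≤ (∫⁻ x, f x ^ 2 ∂μ) * ∫⁻ x, g x ^ 2 ∂μ := by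
  have h := ENNReal.lintegral_mul_le_Lp_mul_Lq μ Real.HolderConjugate.two_two hf hg
  have h2 := pow_le_pow_left' h 2
  refine h2.trans (le_of_eq ?_)
  have e : ∀ t : ℝ≥0∞, (t ^ (1 / 2 : ℝ)) ^ 2 = t := fun t => by
    rw [← ENNReal.rpow_natCast, ← ENNReal.rpow_mul]
    norm_num
  rw [mul_pow, e, e]
  simp

/-- The square of the `L²` norm. -/
def normSq {E : Type*} [NormedAddCommGroup E] {α : Type*} [MeasureSpace α] (f : α → E) : ℝ≥0∞ :=
  ∫⁻ x, ‖f x‖ₑ ^ 2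

theorem normSq_eq_eLpNorm {E : Type*} [NormedAddCommGroup E] {α : Type*} [MeasureSpace α]
    (f : α → E) : normSq f = eLpNorm f 2 volume ^ 2 := by
  rw [eLpNorm_eq_lintegral_rpow_enorm_toReal (by norm_num) (by norm_num)]
  rw [← ENNReal.rpow_natCast, ← ENNReal.rpow_mul]
  simp [normSq]

theorem eLpNorm_schwartz_ne_top (f : SchwartzMap (Rn n) ℂ) : eLpNorm f 2 volume ≠ ∞ :=
  (f.memLp 2 volume).eLpNorm_ne_top

theorem normSq_fourier (f : SchwartzMap (Rn n) ℂ) : normSq (𝓕 f : SchwartzMap (Rn n) ℂ) =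
    normSq f := by
  have h := SchwartzMap.norm_fourier_toL2_eq f
  rw [normSq_eq_eLpNorm, normSq_eq_eLpNorm]
  rw [SchwartzMap.norm_toLp, SchwartzMap.norm_toLp] at h
  rw [(ENNReal.toReal_eq_toReal_iff' (eLpNorm_schwartz_ne_top _)
    (eLpNorm_schwartz_ne_top f)).1 h]

/-- Both sides define the same tempered distribution: pair with a smooth compactly supported
function and move the transform onto it. This makes Plancherel available for the integral transform
of a function known only to lie in L¹ ∩ L². -/
theorem fourierInv_toLp_ae_eq {h : Rn n → ℂ} (h1 : Integrable h) (h2 : MemLp h 2) :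
    (𝓕⁻ (h2.toLp h) : Lp (α := Rn n) ℂ 2 volume) =ᵐ[volume] 𝓕⁻ h := by
  refine ae_eq_of_integral_contDiff_smul_eq ((Lp.memLp _).locallyIntegrable (by norm_num)) ?_ ?_
  · have : Continuous (𝓕⁻ h) := by
      have : Continuous (𝓕 h) := VectorFourier.fourierIntegral_continuous
        Real.continuous_fourierChar (by exact continuous_inner) h1
      rw [show 𝓕⁻ h = fun w => 𝓕 h (-w) from funext fun w => Real.fourierInv_eq_fourier_neg h w]
      exact this.comp continuous_neg
    exact this.locallyIntegrable
  intro g hg hgc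
  have hgs : HasCompactSupport (fun x => (g x : ℂ)) :=
    hgc.comp_left (g := fun t : ℝ => (t : ℂ)) (by simp)
  have hgd : ContDiff ℝ ((⊤ : ℕ∞) : WithTop ℕ∞) (fun x => (g x : ℂ)) :=
    Complex.ofRealCLM.contDiff.comp hg
  let φ : SchwartzMap (Rn n) ℂ := hgs.toSchwartzMap hgd
  have hφ : ∀ x, φ x = (g x : ℂ) := fun x => rfl
  have e1 : (𝓕⁻ (Lp.toTemperedDistribution (h2.toLp h))) φ =
      Lp.toTemperedDistribution (𝓕⁻ (h2.toLp h) : Lp (α := Rn n) ℂ 2 volume) φ := by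
    rw [Lp.fourierInv_toTemperedDistribution_eq]
  rw [TemperedDistribution.fourierInv_apply, Lp.toTemperedDistribution_apply,
    Lp.toTemperedDistribution_apply] at e1
  have e2 : ∫ x, (𝓕⁻ φ) x • (h2.toLp h) x = ∫ x, (𝓕⁻ φ) x • h x :=
    integral_congr_ae (by filter_upwards [h2.coeFn_toLp] with x hx; rw [hx])
  have e3 : ∫ x, (𝓕⁻ φ) x • h x = ∫ x, φ x • 𝓕⁻ h x := by
    have := VectorFourier.integral_fourierIntegral_smul_eq_flip (L := -innerₗ (Rn n))
      (μ := volume) (ν := volume) Real.continuous_fourierChar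
      (by exact (continuous_inner (𝕜 := ℝ) (E := Rn n)).neg) φ.integrable h1
    have i1 : ∀ (F : Rn n → ℂ) x, VectorFourier.fourierIntegral Real.fourierChar volume
        (-innerₗ (Rn n)) F x = 𝓕⁻ F x := fun F x => by
      simp [VectorFourier.fourierIntegral, Real.fourierInv_eq]
    have i2 : ∀ (F : Rn n → ℂ) x, VectorFourier.fourierIntegral Real.fourierChar volume
        (-innerₗ (Rn n)).flip F x = 𝓕⁻ F x := fun F x => by
      simp [VectorFourier.fourierIntegral, Real.fourierInv_eq, real_inner_comm]
    simp only [i1, i2] at this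
    rw [SchwartzMap.fourierInv_coe]
    exact this
  have e4 : ∀ (F : Rn n → ℂ), ∫ x, g x • F x = ∫ x, φ x • F x := fun F => rfl
  rw [e4, e4, ← e3, ← e2, e1]

theorem normSq_fourierInv_le {h : Rn n → ℂ} (h1 : Integrable h) (h2 : MemLp h 2) :
    normSq (𝓕⁻ h) = normSq h := by
  rw [normSq_eq_eLpNorm, normSq_eq_eLpNorm, ← eLpNorm_congr_ae (fourierInv_toLp_ae_eq h1 h2),
    ← eLpNorm_congr_ae h2.coeFn_toLp]
  congr 1
  have e : ‖(𝓕⁻ (h2.toLp h) : Lp (α := Rn n) ℂ 2 volume)‖ = ‖h2.toLp h‖ := by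
    have := Lp.norm_fourier_eq (𝓕⁻ (h2.toLp h) : Lp (α := Rn n) ℂ 2 volume)
    rw [FourierTransform.fourier_fourierInv_eq] at this
    exact this.symm
  rw [Lp.norm_def, Lp.norm_def] at e
  exact (ENNReal.toReal_eq_toReal_iff' (Lp.eLpNorm_ne_top _) (Lp.eLpNorm_ne_top _)).1 e

/-- The bilinear Fourier multiplier operator with the amplitude `a(z, ·, ·)`, in the normalisation
of the Fourier transform of Mathlib. -/
def multiplierOp (a : Rn n × Rn n × Rn n → ℂ) (z : Rn n) (f g : SchwartzMap (Rn n) ℂ)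
    (x : Rn n) : ℂ :=
  ∫ p : Rn n × Rn n, (Real.fourierChar (inner ℝ x (p.1 + p.2)) : ℂ) * a (z, p) *
    ((𝓕 f : SchwartzMap (Rn n) ℂ) p.1 * (𝓕 g : SchwartzMap (Rn n) ℂ) p.2)

theorem hat_two_pi_smul (f : SchwartzMap (Rn n) ℂ) (w : Rn n) :
    hat f ((2 * Real.pi) • w) = (𝓕 f : SchwartzMap (Rn n) ℂ) w := by
  rw [SchwartzMap.fourier_coe, Real.fourier_eq]
  unfold hat
  congr 1
  funext v
  rw [Circle.smul_def, Real.fourierChar_apply, inner_smul_right, smul_eq_mul]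
  congr 2
  push_cast
  ring

/-- Replacing (ξ, η) by 2π(ξ, η) produces the Jacobian (2π)^(2n), which absorbs the prefactor. -/
theorem bilinearOp_eq_multiplierOp (σ : Rn n × Rn n × Rn n → ℂ) (f g : SchwartzMap (Rn n) ℂ)
    (x : Rn n) : bilinearOp σ f g x = multiplierOp (fun q => σ (freqScale q)) x f g x := by
  have : (volume : Measure (Rn n × Rn n)).IsAddHaarMeasure :=
    Measure.prod.instIsAddHaarMeasure _ _
  have h := Measure.integral_comp_smul (volume : Measure (Rn n × Rn n)) (fun p : Rn n × Rn n =>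
      Complex.exp (Complex.I * ((inner ℝ x (p.1 + p.2) : ℝ) : ℂ)) *
        σ (x, p.1, p.2) * hat f p.1 * hat g p.2) (2 * Real.pi)
  have hr : Module.finrank ℝ (Rn n × Rn n) = 2 * n := by simp [two_mul]
  have hpos : (0 : ℝ) < (2 * Real.pi) ^ (2 * n) := by positivity
  rw [hr, abs_of_pos (inv_pos.2 hpos)] at h
  unfold bilinearOp multiplierOp
  rw [show (1 / (2 * (Real.pi : ℂ)) ^ (2 * n)) = ((((2 * Real.pi) ^ (2 * n))⁻¹ : ℝ) : ℂ) by
    push_cast; rw [one_div], ← Complex.real_smul, ← h]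
  congr 1
  funext p
  simp only [Prod.smul_fst, Prod.smul_snd]
  rw [hat_two_pi_smul, hat_two_pi_smul, ← smul_add, inner_smul_right, freqScale_apply,
    Real.fourierChar_apply, mul_assoc (_ * _)]
  congr 3
  push_cast
  ring

theorem integrable_fourier_prod (f g : SchwartzMap (Rn n) ℂ) :
    Integrable (fun p : Rn n × Rn n =>
      (𝓕 f : SchwartzMap (Rn n) ℂ) p.1 * (𝓕 g : SchwartzMap (Rn n) ℂ) p.2) :=
  Integrable.mul_prod (𝓕 f : SchwartzMap (Rn n) ℂ).integrable
    (𝓕 g : SchwartzMap (Rn n) ℂ).integrable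

theorem enorm_fourierChar (t : ℝ) : ‖(Real.fourierChar t : ℂ)‖ₑ = 1 := by
  rw [← ofReal_norm, Circle.norm_coe, ENNReal.ofReal_one]

theorem continuous_phase (x : Rn n) :
    Continuous fun p : Rn n × Rn n => (Real.fourierChar (inner ℝ x (p.1 + p.2)) : ℂ) :=
  continuous_subtype_val.comp (Real.continuous_fourierChar.comp (by fun_prop))

theorem integrable_multiplierOp {a : Rn n × Rn n × Rn n → ℂ} (ha : Continuous a) {A : ℝ}
    (z : Rn n) (hA : ∀ p, ‖a (z, p)‖ ≤ A) (f g : SchwartzMap (Rn n) ℂ) (x : Rn n) :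
    Integrable fun p : Rn n × Rn n =>
      (Real.fourierChar (inner ℝ x (p.1 + p.2)) : ℂ) * a (z, p) *
        ((𝓕 f : SchwartzMap (Rn n) ℂ) p.1 * (𝓕 g : SchwartzMap (Rn n) ℂ) p.2) := by
  refine (integrable_fourier_prod f g).bdd_mul (c := A) ?_ (Filter.Eventually.of_forall fun p => ?_)
  · exact ((continuous_phase x).mul (ha.comp (by fun_prop))).aestronglyMeasurable
  · rw [norm_mul, Circle.norm_coe, one_mul]
    exact hA p

theorem enorm_le_of_amplitude {s B A : ℝ} {k : ℕ} {a : Rn n × Rn n × Rn n → ℂ}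
    (ha : Amplitude s B k A a) (z : Rn n) (p : Rn n × Rn n) :
    ‖a (z, p)‖ₑ ≤ (Metric.closedBall (0 : Rn n) B).indicator (fun _ => ENNReal.ofReal A) p.1 *
      (Metric.closedBall (0 : Rn n) B).indicator (fun _ => 1) p.2 := by
  by_cases h : a (z, p) = 0
  · simp [h]
  obtain ⟨h1, h2⟩ := ha.support z p.1 p.2 h
  rw [Set.indicator_of_mem (by simpa using h1), Set.indicator_of_mem (by simpa using h2), mul_one,
    ← ofReal_norm]
  exact ENNReal.ofReal_le_ofReal (ha.bound _).norm_le

/-- Cauchy-Schwarz in both frequencies at once, hence two ball volumes; Plancherel turns the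
transforms back into f and g. -/
theorem Amplitude.pointwise_bound {s B A : ℝ} {k : ℕ} {a : Rn n × Rn n × Rn n → ℂ}
    (ha : Amplitude s B k A a) (z : Rn n) (f g : SchwartzMap (Rn n) ℂ) (x : Rn n) :
    ‖multiplierOp a z f g x‖ₑ ^ 2 ≤ volume (Metric.closedBall (0 : Rn n) B) ^ 2 *
      ENNReal.ofReal A ^ 2 * (normSq f * normSq g) := by
  set u : SchwartzMap (Rn n) ℂ := 𝓕 f with hu
  set v : SchwartzMap (Rn n) ℂ := 𝓕 g with hv
  have hac : Continuous fun p : Rn n × Rn n => a (z, p) :=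
    ha.smooth.continuous.comp (by fun_prop)
  have h1 : ‖multiplierOp a z f g x‖ₑ ≤ ∫⁻ p : Rn n × Rn n, ‖a (z, p)‖ₑ * ‖u p.1 * v p.2‖ₑ := by
    refine (enorm_integral_le_lintegral_enorm _).trans (le_of_eq (lintegral_congr fun p => ?_))
    rw [enorm_mul, enorm_mul, enorm_fourierChar, one_mul]
  have h2 := lintegral_mul_sq_le (μ := (volume : Measure (Rn n × Rn n)))
    (f := fun p => ‖a (z, p)‖ₑ) (g := fun p => ‖u p.1 * v p.2‖ₑ)
    hac.enorm.aemeasurable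
    ((u.continuous.comp continuous_fst).mul (v.continuous.comp continuous_snd)).enorm.aemeasurable
  refine (pow_le_pow_left' h1 2).trans (h2.trans ?_)
  have hball : MeasurableSet (Metric.closedBall (0 : Rn n) B) := measurableSet_closedBall
  gcongr
  · calc ∫⁻ p : Rn n × Rn n, ‖a (z, p)‖ₑ ^ 2
        ≤ ∫⁻ p : Rn n × Rn n,
          (Metric.closedBall (0 : Rn n) B).indicator (fun _ => ENNReal.ofReal A ^ 2) p.1 *
          (Metric.closedBall (0 : Rn n) B).indicator (fun _ => 1) p.2 := by
          refine lintegral_mono fun p => ?_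
          refine (pow_le_pow_left' (enorm_le_of_amplitude ha z p) 2).trans (le_of_eq ?_)
          by_cases h1 : p.1 ∈ Metric.closedBall (0 : Rn n) B <;>
          by_cases h2 : p.2 ∈ Metric.closedBall (0 : Rn n) B <;> simp [h1, h2, Set.indicator]
      _ = volume (Metric.closedBall (0 : Rn n) B) ^ 2 * ENNReal.ofReal A ^ 2 := by
          rw [Measure.volume_eq_prod, lintegral_prod_mul
            (measurable_const.indicator hball).aemeasurable
            (measurable_const.indicator hball).aemeasurable,
            lintegral_indicator hball, lintegral_indicator hball]
          simp
          ring
  · rw [← normSq_fourier f, ← normSq_fourier g, ← hu, ← hv]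
    refine le_of_eq ?_
    unfold normSq
    rw [← lintegral_prod_mul (u.continuous.enorm.measurable.pow_const 2).aemeasurable
      (v.continuous.enorm.measurable.pow_const 2).aemeasurable, Measure.volume_eq_prod]
    refine lintegral_congr fun p => ?_
    rw [enorm_mul, mul_pow]

/-- In the variable ζ = ξ + η the operator is the inverse Fourier transform of h(ζ) = ∫ a(z, ξ, ζ-ξ)
f̂(ξ) ĝ(ζ-ξ) dξ. Plancherel handles ζ, so Cauchy-Schwarz is needed in ξ alone and only one ball
volume is lost. -/
theorem Amplitude.normSq_bound {s B A : ℝ} {k : ℕ} {a : Rn n × Rn n × Rn n → ℂ}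
    (ha : Amplitude s B k A a) (z : Rn n) (f g : SchwartzMap (Rn n) ℂ) :
    normSq (multiplierOp a z f g) ≤ volume (Metric.closedBall (0 : Rn n) B) *
      ENNReal.ofReal A ^ 2 * (normSq f * normSq g) := by
  set u : SchwartzMap (Rn n) ℂ := 𝓕 f with hu
  set v : SchwartzMap (Rn n) ℂ := 𝓕 g with hv
  have hac : Continuous fun p : Rn n × Rn n => a (z, p) :=
    ha.smooth.continuous.comp (by fun_prop)
  let M : Rn n × Rn n → ℂ := fun p => a (z, p) * (u p.1 * v p.2)
  have hMc : Continuous M :=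
    hac.mul ((u.continuous.comp continuous_fst).mul (v.continuous.comp continuous_snd))
  have hM : Integrable M := (integrable_fourier_prod f g).bdd_mul (c := A)
    hac.aestronglyMeasurable (Filter.Eventually.of_forall fun p => (ha.bound _).norm_le)
  let S : Rn n × Rn n → Rn n × Rn n := fun q => (q.1, -q.1 + q.2)
  have hS : MeasurePreserving S (volume.prod volume) (volume.prod volume) :=
    (measurePreserving_prod_add (volume : Measure (Rn n)) (volume : Measure (Rn n))).symm
      (MeasurableEquiv.shearAddRight (Rn n))
  have hSe : MeasurableEmbedding S :=
    (MeasurableEquiv.shearAddRight (Rn n)).symm.measurableEmbedding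
  let h : Rn n → ℂ := fun ζ => ∫ ξ, M (ξ, -ξ + ζ)
  have hMS : Integrable (fun q : Rn n × Rn n => M (S q)) (volume.prod volume) := by
    exact hS.integrable_comp_of_integrable hM
  have hh1 : Integrable h := hMS.integral_prod_right
  have hop : multiplierOp a z f g = 𝓕⁻ h := by
    funext x
    rw [Real.fourierInv_eq]
    unfold multiplierOp
    rw [Measure.volume_eq_prod, ← hS.integral_comp hSe]
    have hI : Integrable (fun q : Rn n × Rn n =>
        (Real.fourierChar (inner ℝ x q.2) : ℂ) * M (S q)) (volume.prod volume) := by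
      refine hMS.bdd_mul (c := 1) ?_ (Filter.Eventually.of_forall fun p => ?_)
      · exact (continuous_subtype_val.comp (Real.continuous_fourierChar.comp
          (by fun_prop))).aestronglyMeasurable
      · rw [Circle.norm_coe]
    calc _ = ∫ q : Rn n × Rn n, (Real.fourierChar (inner ℝ x q.2) : ℂ) * M (S q)
          ∂(volume.prod volume) := by
          refine integral_congr_ae (Filter.Eventually.of_forall fun q => ?_)
          simp only [S, M]
          rw [add_neg_cancel_left, mul_assoc]
      _ = _ := by
          rw [integral_prod_symm _ hI]
          refine integral_congr_ae (Filter.Eventually.of_forall fun ζ => ?_)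
          simp only [h, S]
          rw [integral_const_mul, Circle.smul_def, smul_eq_mul, real_inner_comm]
  have hball : MeasurableSet (Metric.closedBall (0 : Rn n) B) := measurableSet_closedBall
  have hbound : normSq h ≤ volume (Metric.closedBall (0 : Rn n) B) *
      ENNReal.ofReal A ^ 2 * (normSq f * normSq g) := by
    have hpt : ∀ ζ, ‖h ζ‖ₑ ^ 2 ≤ volume (Metric.closedBall (0 : Rn n) B) * ENNReal.ofReal A ^ 2 *
        ∫⁻ ξ, ‖u ξ‖ₑ ^ 2 * ‖v (-ξ + ζ)‖ₑ ^ 2 := by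
      intro ζ
      have h1 : ‖h ζ‖ₑ ≤ ∫⁻ ξ, ‖a (z, ξ, -ξ + ζ)‖ₑ * ‖u ξ * v (-ξ + ζ)‖ₑ := by
        refine (enorm_integral_le_lintegral_enorm _).trans (le_of_eq (lintegral_congr fun p => ?_))
        exact enorm_mul _ _
      have hshift : Continuous fun ξ : Rn n => -ξ + ζ := by fun_prop
      refine (pow_le_pow_left' h1 2).trans ((lintegral_mul_sq_le
        (hac.comp (continuous_id.prodMk hshift)).enorm.aemeasurable
        (u.continuous.mul (v.continuous.comp hshift)).enorm.aemeasurable).trans ?_)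
      gcongr
      · calc ∫⁻ ξ, ‖a (z, ξ, -ξ + ζ)‖ₑ ^ 2 ≤ ∫⁻ ξ, (Metric.closedBall (0 : Rn n) B).indicator
              (fun _ => ENNReal.ofReal A ^ 2) ξ := by
              refine lintegral_mono fun ξ => ?_
              have := enorm_le_of_amplitude ha z (ξ, -ξ + ζ)
              refine (pow_le_pow_left' this 2).trans ?_
              by_cases h1 : ξ ∈ Metric.closedBall (0 : Rn n) B <;>
              by_cases h2 : -ξ + ζ ∈ Metric.closedBall (0 : Rn n) B <;>
                simp [h1, h2, Set.indicator]
          _ = _ := by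
              rw [lintegral_indicator hball]
              simp [mul_comm]
      · simp [enorm_mul, mul_pow]
    calc normSq h ≤ ∫⁻ ζ, volume (Metric.closedBall (0 : Rn n) B) * ENNReal.ofReal A ^ 2 *
          ∫⁻ ξ, ‖u ξ‖ₑ ^ 2 * ‖v (-ξ + ζ)‖ₑ ^ 2 := lintegral_mono hpt
      _ = volume (Metric.closedBall (0 : Rn n) B) * ENNReal.ofReal A ^ 2 *
          ∫⁻ ζ, ∫⁻ ξ, ‖u ξ‖ₑ ^ 2 * ‖v (-ξ + ζ)‖ₑ ^ 2 := by
          rw [lintegral_const_mul']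
          exact ENNReal.mul_ne_top measure_closedBall_lt_top.ne (by simp)
      _ = _ := by
          congr 1
          have hm : Measurable fun q : Rn n × Rn n => ‖u q.1‖ₑ ^ 2 * ‖v (-q.1 + q.2)‖ₑ ^ 2 := by
            have h1 : Continuous fun q : Rn n × Rn n => ‖u q.1‖ₑ :=
              (u.continuous.comp continuous_fst).enorm
            have h2 : Continuous fun q : Rn n × Rn n => ‖v (-q.1 + q.2)‖ₑ :=
              (v.continuous.comp (by fun_prop)).enorm
            exact (h1.measurable.pow_const 2).mul (h2.measurable.pow_const 2)
          rw [← normSq_fourier f, ← normSq_fourier g, ← hu, ← hv]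
          unfold normSq
          rw [← lintegral_prod_symm (fun q : Rn n × Rn n => ‖u q.1‖ₑ ^ 2 * ‖v (-q.1 + q.2)‖ₑ ^ 2)
            hm.aemeasurable, ← lintegral_prod_mul (u.continuous.enorm.measurable.pow_const 2).aemeasurable
            (v.continuous.enorm.measurable.pow_const 2).aemeasurable,
            ← hS.lintegral_comp_emb hSe (fun q : Rn n × Rn n => ‖u q.1‖ₑ ^ 2 * ‖v q.2‖ₑ ^ 2)]
  have hfin : normSq h ≠ ∞ := by
    refine ne_top_of_le_ne_top ?_ hbound
    have hN : ∀ f : SchwartzMap (Rn n) ℂ, normSq f ≠ ∞ := fun f => by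
      rw [normSq_eq_eLpNorm]
      exact ENNReal.pow_ne_top (eLpNorm_schwartz_ne_top f)
    exact ENNReal.mul_ne_top (ENNReal.mul_ne_top measure_closedBall_lt_top.ne (by simp))
      (ENNReal.mul_ne_top (hN f) (hN g))
  have hh2 : MemLp h 2 := by
    refine ⟨hh1.aestronglyMeasurable, ?_⟩
    rw [normSq_eq_eLpNorm] at hfin
    exact lt_top_iff_ne_top.2 fun h0 => hfin (by rw [h0]; simp)
  rw [hop, normSq_fourierInv_le hh1 hh2]
  exact hbound

end BilinearMultipliers

/-! ### Transfer of polynomial weights from the inputs to the output. -/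

section Weights

open scoped FourierTransform

variable {n : ℕ}

theorem Amplitude.of_le {s B A : ℝ} {k l : ℕ} {a : Rn n × Rn n × Rn n → ℂ}
    (ha : Amplitude s B l A a) (hkl : k ≤ l) : Amplitude s B k A a :=
  ⟨ha.smooth, ha.support, fun q => (ha.bound q).of_le hkl⟩

theorem Amplitude.eventuallyEq_zero {s B A : ℝ} {k : ℕ} {a : Rn n × Rn n × Rn n → ℂ}
    (ha : Amplitude s B k A a) {q : Rn n × Rn n × Rn n} (hq : ¬ (‖q.2.1‖ ≤ B ∧ ‖q.2.2‖ ≤ B)) :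
    a =ᶠ[nhds q] 0 := by
  have hopen : IsOpen {q : Rn n × Rn n × Rn n | ¬ (‖q.2.1‖ ≤ B ∧ ‖q.2.2‖ ≤ B)} := by
    have h1 : Continuous fun q : Rn n × Rn n × Rn n => ‖q.2.1‖ := by fun_prop
    have h2 : Continuous fun q : Rn n × Rn n × Rn n => ‖q.2.2‖ := by fun_prop
    exact ((isClosed_le h1 continuous_const).inter (isClosed_le h2 continuous_const)).isOpen_compl
  filter_upwards [hopen.mem_nhds hq] with p hp
  by_contra h
  exact hp (ha.support _ _ _ h)

theorem Amplitude.deriv {s B A : ℝ} {k : ℕ} {a : Rn n × Rn n × Rn n → ℂ}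
    (ha : Amplitude s B (k + 1) A a) (d : Fin n ⊕ Fin n ⊕ Fin n) :
    Amplitude s B k A (dirDeriv (scaledDir s⁻¹ s d) a) := by
  refine ⟨ha.smooth.dirDeriv _, fun x ξ η h => ?_, fun q => (ha.bound q).2 d⟩
  by_contra hcon
  exact h (dirDeriv_eq_zero_of_eventuallyEq
    (ha.eventuallyEq_zero (q := (x, ξ, η)) hcon) _)

theorem continuous_multiplierOp {a : Rn n × Rn n × Rn n → ℂ} (ha : Continuous a) {A : ℝ}
    (hA : ∀ q, ‖a q‖ ≤ A) (f g : SchwartzMap (Rn n) ℂ) :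
    Continuous fun y : Rn n × Rn n => multiplierOp a y.1 f g y.2 := by
  unfold multiplierOp
  refine continuous_of_dominated (bound := fun p => A *
    ‖(𝓕 f : SchwartzMap (Rn n) ℂ) p.1 * (𝓕 g : SchwartzMap (Rn n) ℂ) p.2‖) (fun y =>
      (integrable_multiplierOp ha y.1 (fun p => hA _) f g y.2).aestronglyMeasurable)
    (fun y => Filter.Eventually.of_forall fun p => ?_) ((integrable_fourier_prod f g).norm.const_mul A)
    (Filter.Eventually.of_forall fun p => ?_)
  · rw [norm_mul, norm_mul, Circle.norm_coe, one_mul]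
    gcongr
    exact hA _
  · have h1 : Continuous fun y : Rn n × Rn n =>
        (Real.fourierChar (inner ℝ y.2 (p.1 + p.2)) : ℂ) :=
      continuous_subtype_val.comp (Real.continuous_fourierChar.comp (by fun_prop))
    have h2 : Continuous fun y : Rn n × Rn n => a (y.1, p) := ha.comp (by fun_prop)
    exact (h1.mul h2).mul continuous_const

theorem fderiv_phase_mul {a : Rn n × Rn n × Rn n → ℂ} (ha : Smooth a) (z x : Rn n)
    (p w : Rn n × Rn n) :
    fderiv ℝ (fun p : Rn n × Rn n =>
      (Real.fourierChar (inner ℝ x (p.1 + p.2)) : ℂ) * a (z, p)) p w =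
    (Real.fourierChar (inner ℝ x (p.1 + p.2)) : ℂ) *
      (2 * Real.pi * Complex.I * (inner ℝ x (w.1 + w.2) : ℝ) * a (z, p) +
        dirDeriv (0, w) a (z, p)) := by
  let ℓ : (Rn n × Rn n) →L[ℝ] ℝ := (innerSL ℝ x).comp
    (ContinuousLinearMap.fst ℝ (Rn n) (Rn n) + ContinuousLinearMap.snd ℝ (Rn n) (Rn n))
  have hℓ : ∀ p, ℓ p = inner ℝ x (p.1 + p.2) := fun p => by simp [ℓ, inner_add_right]
  have h1 : HasFDerivAt (fun p : Rn n × Rn n => (Real.fourierChar (ℓ p) : ℂ)) _ p :=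
    (Real.hasDerivAt_fourierChar (ℓ p)).hasFDerivAt.comp p ℓ.hasFDerivAt
  have h2 : HasFDerivAt (fun p : Rn n × Rn n => a (z, p)) _ p :=
    (ha.differentiable (z, p)).hasFDerivAt.comp p (hasFDerivAt_prodMk_right z p)
  have h3 := (h1.mul h2).fderiv
  simp only [hℓ] at h3
  rw [show (fun p : Rn n × Rn n => (Real.fourierChar (inner ℝ x (p.1 + p.2)) : ℂ) * a (z, p)) =
    (fun p : Rn n × Rn n => (Real.fourierChar (inner ℝ x (p.1 + p.2)) : ℂ)) *
      (fun p : Rn n × Rn n => a (z, p)) from rfl, h3]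
  simp [hℓ, dirDeriv]
  ring

theorem integral_phase_by_parts {a : Rn n × Rn n × Rn n → ℂ} (ha : Smooth a) {A A' : ℝ}
    (z x : Rn n) (w : Rn n × Rn n) (hA : ∀ q, ‖a q‖ ≤ A) (hA' : ∀ q, ‖dirDeriv (0, w) a q‖ ≤ A')
    {Q : Rn n × Rn n → ℂ} (hQ : Differentiable ℝ Q) (hQi : Integrable Q)
    (hQi' : Integrable fun p => fderiv ℝ Q p w) :
    ∫ p : Rn n × Rn n, (Real.fourierChar (inner ℝ x (p.1 + p.2)) : ℂ) * a (z, p) *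
      fderiv ℝ Q p w = - ∫ p : Rn n × Rn n,
        (Real.fourierChar (inner ℝ x (p.1 + p.2)) : ℂ) *
      (2 * Real.pi * Complex.I * (inner ℝ x (w.1 + w.2) : ℝ) * a (z, p) +
        dirDeriv (0, w) a (z, p)) * Q p := by
  have : (volume : Measure (Rn n × Rn n)).IsAddHaarMeasure :=
    Measure.prod.instIsAddHaarMeasure _ _
  have hac : Continuous fun p : Rn n × Rn n => a (z, p) := ha.continuous.comp (by fun_prop)
  have hac' : Continuous fun p : Rn n × Rn n => dirDeriv (0, w) a (z, p) :=
    (ha.dirDeriv _).continuous.comp (by fun_prop)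
  have hPd : Differentiable ℝ fun p : Rn n × Rn n =>
      (Real.fourierChar (inner ℝ x (p.1 + p.2)) : ℂ) * a (z, p) := by
    refine Differentiable.mul ?_ (ha.differentiable.comp (by fun_prop))
    have h : Differentiable ℝ fun p : Rn n × Rn n => (inner ℝ x (p.1 + p.2) : ℝ) :=
      (innerSL ℝ x).differentiable.comp (by fun_prop)
    exact Real.differentiable_fourierChar.comp h
  simp only [← fderiv_phase_mul ha]
  have hb : ∀ p : Rn n × Rn n,
      ‖(Real.fourierChar (inner ℝ x (p.1 + p.2)) : ℂ) * a (z, p)‖ ≤ A := fun p => by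
    rw [norm_mul, Circle.norm_coe, one_mul]; exact hA _
  have hm := ((continuous_phase x).mul hac).aestronglyMeasurable (μ := volume)
  refine integral_mul_fderiv_eq_neg_fderiv_mul_of_integrable ?_
    (hQi'.bdd_mul hm (Filter.Eventually.of_forall hb))
    (hQi.bdd_mul hm (Filter.Eventually.of_forall hb)) (fun p _ => hPd p) (fun p _ => hQ p)
  simp only [fderiv_phase_mul ha]
  refine hQi.bdd_mul (c := ‖(2 * Real.pi * Complex.I * (inner ℝ x (w.1 + w.2) : ℝ) : ℂ)‖ * A + A') ?_
    (Filter.Eventually.of_forall fun p => ?_)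
  · exact ((continuous_phase x).mul ((continuous_const.mul hac).add hac')).aestronglyMeasurable
  · rw [norm_mul, Circle.norm_coe, one_mul]
    refine (norm_add_le _ _).trans (add_le_add ?_ (hA' _))
    rw [norm_mul]
    gcongr
    exact hA _

/-- The factor `1 + 2πi s (y_j - c_j)`. -/
def weight (s : ℝ) (c : Rn n) (j : Fin n) (y : Rn n) : ℂ :=
  1 + 2 * Real.pi * Complex.I * ((s * (y j - c j) : ℝ) : ℂ)

theorem norm_weight_sq (s : ℝ) (c : Rn n) (j : Fin n) (y : Rn n) :
    ‖weight s c j y‖ ^ 2 = 1 + (2 * Real.pi * s * (y j - c j)) ^ 2 := by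
  rw [← Complex.normSq_eq_norm_sq]
  simp only [weight, Complex.normSq_apply]
  simp
  ring

theorem weight_ne_zero (s : ℝ) (c : Rn n) (j : Fin n) (y : Rn n) : weight s c j y ≠ 0 := by
  intro h
  have := norm_weight_sq s c j y
  rw [h] at this
  simp at this
  nlinarith [sq_nonneg (2 * Real.pi * s * (y j - c j))]

theorem hasTemperateGrowth_weight (s : ℝ) (c : Rn n) (j : Fin n) :
    (fun y : Rn n => 2 * Real.pi * s * (y j - c j)).HasTemperateGrowth := by
  have h1 : (fun y : Rn n => y j).HasTemperateGrowth :=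
    (EuclideanSpace.proj (𝕜 := ℝ) j : Rn n →L[ℝ] ℝ).hasTemperateGrowth
  exact (Function.HasTemperateGrowth.const (2 * Real.pi * s)).mul
    (h1.sub (Function.HasTemperateGrowth.const (c j)))

/-- The inverse is conj(w)/|w|², a linear polynomial times (1 + b²)⁻¹ with b real and affine. -/
theorem hasTemperateGrowth_weight_inv (s : ℝ) (c : Rn n) (j : Fin n) :
    (fun y => (weight s c j y)⁻¹).HasTemperateGrowth := by
  have hb := hasTemperateGrowth_weight s c j
  have h1 := (Function.hasTemperateGrowth_one_add_norm_sq_rpow (H := ℝ) (-1)).comp hb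
  have h2 := Function.Complex.hasTemperateGrowth_ofReal.comp h1
  have h3 := (Function.HasTemperateGrowth.const (1 : ℂ)).sub
    ((Function.HasTemperateGrowth.const Complex.I).mul (Function.Complex.hasTemperateGrowth_ofReal.comp hb))
  convert h3.mul h2 using 1
  · rfl
  · rfl
  funext y
  have hne := weight_ne_zero s c j y
  simp only [Pi.mul_apply, Pi.sub_apply, Function.comp_apply, Real.norm_eq_abs, sq_abs]
  rw [Real.rpow_neg_one, ← norm_weight_sq, inv_eq_iff_eq_inv, eq_comm]
  push_cast
  rw [mul_inv, inv_inv, ← Complex.mul_conj']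
  have e : (1 : ℂ) - Complex.I * (2 * Real.pi * s * ((y j : ℝ) - (c j : ℝ))) =
      (starRingEnd ℂ) (weight s c j y) := by
    simp [weight]
    rw [show (starRingEnd ℂ) 2 = 2 from map_ofNat _ 2]
    ring
  rw [e]
  have : (starRingEnd ℂ) (weight s c j y) ≠ 0 := by simpa using hne
  field_simp

/-- Division of a Schwartz function by the weight. -/
def divWeight (s : ℝ) (c : Rn n) (f : SchwartzMap (Rn n) ℂ) (j : Fin n) : SchwartzMap (Rn n) ℂ :=
  SchwartzMap.smulLeftCLM ℂ (fun y => (weight s c j y)⁻¹) f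

theorem divWeight_apply (s : ℝ) (c : Rn n) (f : SchwartzMap (Rn n) ℂ) (j : Fin n) (y : Rn n) :
    divWeight s c f j y = (weight s c j y)⁻¹ * f y := by
  simp [divWeight, SchwartzMap.smulLeftCLM_apply_apply (hasTemperateGrowth_weight_inv s c j)]

-- Write f as the weight times F = `divWeight s c f j`; under the Fourier transform, multiplication
-- by y_j becomes differentiation in ξ_j.
open LineDeriv in
theorem fourier_eq_divWeight (s : ℝ) (c : Rn n) (f : SchwartzMap (Rn n) ℂ) (j : Fin n)
    (ξ : Rn n) : (𝓕 f : SchwartzMap (Rn n) ℂ) ξ =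
      (1 - 2 * Real.pi * Complex.I * ((s * c j : ℝ) : ℂ)) *
        (𝓕 (divWeight s c f j) : SchwartzMap (Rn n) ℂ) ξ -
      s * fderiv ℝ (𝓕 (divWeight s c f j) : SchwartzMap (Rn n) ℂ) ξ (stdVec j) := by
  set F := divWeight s c f j with hF
  have hTG : (fun y : Rn n => inner ℝ y (stdVec j)).HasTemperateGrowth :=
    Function.hasTemperateGrowth_inner_left _
  have h1 : f = (1 - 2 * Real.pi * Complex.I * ((s * c j : ℝ) : ℂ)) • F -
      (s : ℂ) • (-(2 * Real.pi * Complex.I) • SchwartzMap.smulLeftCLM ℂ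
        (fun y : Rn n => inner ℝ y (stdVec j)) F) := by
    ext y
    have : f y = weight s c j y * F y := by
      rw [hF, divWeight_apply, mul_inv_cancel_left₀ (weight_ne_zero s c j y)]
    have e : (inner ℝ y (stdVec j) : ℝ) = y j := by
      simp [stdVec, EuclideanSpace.inner_single_right]
    simp [SchwartzMap.smulLeftCLM_apply_apply hTG, this, weight, e]
    ring
  have h2 := SchwartzMap.lineDerivOp_fourier_eq F (stdVec j)
  have h3 : 𝓕 f = (1 - 2 * Real.pi * Complex.I * ((s * c j : ℝ) : ℂ)) • 𝓕 F -
      (s : ℂ) • ∂_{stdVec j} (𝓕 F) := by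
    rw [h2]
    conv_lhs => rw [h1]
    rw [sub_eq_add_neg, FourierTransform.fourier_add, FourierTransform.fourier_smul,
      FourierTransform.fourier_neg, FourierTransform.fourier_smul, ← sub_eq_add_neg]
  rw [h3]
  rfl

theorem integrable_fourier_fderiv (f g : SchwartzMap (Rn n) ℂ) (v : Rn n) :
    Integrable (fun p : Rn n × Rn n => fderiv ℝ (𝓕 f : SchwartzMap (Rn n) ℂ) p.1 v *
      (𝓕 g : SchwartzMap (Rn n) ℂ) p.2) :=
  Integrable.mul_prod (LineDeriv.lineDerivOp v (𝓕 f : SchwartzMap (Rn n) ℂ)).integrable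
    (𝓕 g : SchwartzMap (Rn n) ℂ).integrable

/-- After `fourier_eq_divWeight`, integrate the ξ_j-derivative by parts. On the phase it yields 2πi
s x_j, which joins the constant 1 - 2πi s c_j to form the same weight at x; on the amplitude it
yields the normalised derivative, again an amplitude of the same size. -/
theorem multiplierOp_divWeight_left {s B A : ℝ} {k : ℕ} {a : Rn n × Rn n × Rn n → ℂ}
    (ha : Amplitude s B (k + 1) A a) (z c : Rn n) (j : Fin n) (f g : SchwartzMap (Rn n) ℂ)
    (x : Rn n) : multiplierOp a z f g x =
      weight s c j x * multiplierOp a z (divWeight s c f j) g x +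
      multiplierOp (dirDeriv (scaledDir s⁻¹ s (Sum.inr (Sum.inl j))) a) z
        (divWeight s c f j) g x := by
  set F := divWeight s c f j with hF
  have hA : ∀ q, ‖a q‖ ≤ A := fun q => (ha.bound q).norm_le
  have hd := ha.deriv (Sum.inr (Sum.inl j))
  have hA' : ∀ q, ‖dirDeriv (0, s • (stdVec j, 0)) a q‖ ≤ A := fun q => by
    have := (hd.bound q).norm_le
    simpa [scaledDir] using this
  set Q : Rn n × Rn n → ℂ := fun p =>
    (𝓕 F : SchwartzMap (Rn n) ℂ) p.1 * (𝓕 g : SchwartzMap (Rn n) ℂ) p.2 with hQ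
  have hQd : ∀ p : Rn n × Rn n, fderiv ℝ Q p (s • (stdVec j, 0)) =
      s * (fderiv ℝ (𝓕 F : SchwartzMap (Rn n) ℂ) p.1 (stdVec j) *
        (𝓕 g : SchwartzMap (Rn n) ℂ) p.2) := fun p => by
    have h1 : HasFDerivAt (fun p : Rn n × Rn n => (𝓕 F : SchwartzMap (Rn n) ℂ) p.1) _ p :=
      ((𝓕 F : SchwartzMap (Rn n) ℂ).differentiable p.1).hasFDerivAt.comp p hasFDerivAt_fst
    have h2 : HasFDerivAt (fun p : Rn n × Rn n => (𝓕 g : SchwartzMap (Rn n) ℂ) p.2) _ p :=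
      ((𝓕 g : SchwartzMap (Rn n) ℂ).differentiable p.2).hasFDerivAt.comp p hasFDerivAt_snd
    have h3 := (h1.mul h2).fderiv
    rw [hQ]
    change fderiv ℝ ((fun p : Rn n × Rn n => (𝓕 F : SchwartzMap (Rn n) ℂ) p.1) *
      (fun p : Rn n × Rn n => (𝓕 g : SchwartzMap (Rn n) ℂ) p.2)) p _ = _
    rw [h3]
    simp
    ring
  have hQi := integrable_fourier_prod F g
  have hQdi : Integrable fun p => fderiv ℝ Q p (s • (stdVec j, 0)) := by
    simp only [hQd]
    exact (integrable_fourier_fderiv F g _).const_mul _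
  have hQdiff : Differentiable ℝ Q :=
    ((𝓕 F : SchwartzMap (Rn n) ℂ).differentiable.comp differentiable_fst).mul
      ((𝓕 g : SchwartzMap (Rn n) ℂ).differentiable.comp differentiable_snd)
  have hibp := integral_phase_by_parts ha.smooth z x (s • (stdVec j, 0)) hA hA' hQdiff hQi hQdi
  have hdir : ((0 : Rn n), s • ((stdVec j : Rn n), (0 : Rn n))) =
      scaledDir s⁻¹ s (Sum.inr (Sum.inl j)) := by simp [scaledDir]
  have hI1 := integrable_multiplierOp ha.smooth.continuous z (fun p => hA _) F g x
  have hI2 := integrable_multiplierOp hd.smooth.continuous z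
    (fun p => (hd.bound (z, p)).norm_le) F g x
  have hI3 : Integrable fun p : Rn n × Rn n =>
      (Real.fourierChar (inner ℝ x (p.1 + p.2)) : ℂ) * a (z, p) *
        fderiv ℝ Q p (s • (stdVec j, 0)) :=
    hQdi.bdd_mul (c := A) ((continuous_phase x).mul
      (ha.smooth.continuous.comp (by fun_prop))).aestronglyMeasurable
      (Filter.Eventually.of_forall fun p => by
        rw [norm_mul, Circle.norm_coe, one_mul]; exact hA _)
  have e1 : multiplierOp a z f g x = ∫ p : Rn n × Rn n,
      ((1 - 2 * Real.pi * Complex.I * ((s * c j : ℝ) : ℂ)) *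
        ((Real.fourierChar (inner ℝ x (p.1 + p.2)) : ℂ) * a (z, p) * Q p) -
        (Real.fourierChar (inner ℝ x (p.1 + p.2)) : ℂ) * a (z, p) *
          fderiv ℝ Q p (s • (stdVec j, 0))) := by
    unfold multiplierOp
    refine integral_congr_ae (Filter.Eventually.of_forall fun p => ?_)
    simp only [hQd]
    rw [fourier_eq_divWeight s c f j, ← hF, hQ]
    ring
  have e2 : ∫ p : Rn n × Rn n, (Real.fourierChar (inner ℝ x (p.1 + p.2)) : ℂ) *
      (2 * Real.pi * Complex.I * (inner ℝ x ((s • ((stdVec j : Rn n), (0 : Rn n))).1 +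
        (s • ((stdVec j : Rn n), (0 : Rn n))).2) : ℝ) * a (z, p) +
        dirDeriv (0, s • (stdVec j, 0)) a (z, p)) * Q p =
      2 * Real.pi * Complex.I * ((s * x j : ℝ) : ℂ) * multiplierOp a z F g x +
      multiplierOp (dirDeriv (scaledDir s⁻¹ s (Sum.inr (Sum.inl j))) a) z F g x := by
    unfold multiplierOp
    rw [← integral_const_mul, ← integral_add (hI1.const_mul _) hI2]
    refine integral_congr_ae (Filter.Eventually.of_forall fun p => ?_)
    have e : (inner ℝ x ((s • ((stdVec j : Rn n), (0 : Rn n))).1 +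
        (s • ((stdVec j : Rn n), (0 : Rn n))).2) : ℝ) = s * x j := by
      simp [stdVec, inner_smul_right, EuclideanSpace.inner_single_right]
    simp only [e, hdir, hQ]
    ring
  rw [e1, integral_sub (hI1.const_mul _) hI3, hibp, e2, integral_const_mul]
  simp only [weight]
  unfold multiplierOp
  push_cast
  ring

/-- Interchange of the two frequency variables. -/
def freqSwap : (Rn n × Rn n × Rn n) →L[ℝ] (Rn n × Rn n × Rn n) :=
  (ContinuousLinearMap.fst ℝ _ _).prod
    (((ContinuousLinearMap.snd ℝ _ _).comp (ContinuousLinearMap.snd ℝ _ _)).prod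
      ((ContinuousLinearMap.fst ℝ _ _).comp (ContinuousLinearMap.snd ℝ _ _)))

theorem freqSwap_apply (q : Rn n × Rn n × Rn n) : freqSwap q = (q.1, q.2.2, q.2.1) := rfl

theorem DerivBound.comp_equiv {V ι κ : Type*} [NormedAddCommGroup V] [NormedSpace ℝ V]
    {v : ι → V} {k : ℕ} {A : ℝ} {F : V → ℂ} {p : V} (h : DerivBound v k A F p) (e : κ → ι) :
    DerivBound (fun d => v (e d)) k A F p := by
  induction k generalizing F with
  | zero => exact h
  | succ k ih => exact ⟨h.1, fun d => ih (h.2 (e d))⟩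

/-- Interchange of the two groups of frequency directions. -/
def dirSwap : Fin n ⊕ Fin n ⊕ Fin n → Fin n ⊕ Fin n ⊕ Fin n
  | Sum.inl j => Sum.inl j
  | Sum.inr (Sum.inl j) => Sum.inr (Sum.inr j)
  | Sum.inr (Sum.inr j) => Sum.inr (Sum.inl j)

theorem freqSwap_scaledDir (c₁ c₂ : ℝ) (d : Fin n ⊕ Fin n ⊕ Fin n) :
    freqSwap (scaledDir c₁ c₂ d) = scaledDir c₁ c₂ (dirSwap d) := by
  rcases d with j | j | j <;> simp [freqSwap_apply, scaledDir, dirSwap]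

theorem Amplitude.swap {s B A : ℝ} {k : ℕ} {a : Rn n × Rn n × Rn n → ℂ}
    (ha : Amplitude s B k A a) : Amplitude s B k A (fun q => a (freqSwap q)) := by
  refine ⟨ha.smooth.comp freqSwap.contDiff, fun x ξ η h => (ha.support x η ξ h).symm, fun q => ?_⟩
  refine DerivBound.comp_clm ha.smooth freqSwap ?_
  simp only [freqSwap_scaledDir]
  exact (ha.bound _).comp_equiv _

theorem multiplierOp_swap (a : Rn n × Rn n × Rn n → ℂ) (z : Rn n) (f g : SchwartzMap (Rn n) ℂ)
    (x : Rn n) : multiplierOp (fun q => a (freqSwap q)) z g f x = multiplierOp a z f g x := by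
  unfold multiplierOp
  rw [Measure.volume_eq_prod, ← integral_prod_swap]
  refine integral_congr_ae (Filter.Eventually.of_forall fun p => ?_)
  simp only [freqSwap_apply, Prod.fst_swap, Prod.snd_swap]
  rw [add_comm p.2 p.1, mul_comm ((𝓕 g : SchwartzMap (Rn n) ℂ) p.2)]

theorem multiplierOp_divWeight_right {s B A : ℝ} {k : ℕ} {a : Rn n × Rn n × Rn n → ℂ}
    (ha : Amplitude s B (k + 1) A a) (z c : Rn n) (j : Fin n) (f g : SchwartzMap (Rn n) ℂ)
    (x : Rn n) : multiplierOp a z f g x =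
      weight s c j x * multiplierOp a z f (divWeight s c g j) x +
      multiplierOp (dirDeriv (scaledDir s⁻¹ s (Sum.inr (Sum.inr j))) a) z
        f (divWeight s c g j) x := by
  rw [← multiplierOp_swap a, multiplierOp_divWeight_left ha.swap z c j, multiplierOp_swap]
  congr 1
  rw [← multiplierOp_swap (dirDeriv _ a), dirDeriv_comp_clm ha.smooth.differentiable,
    freqSwap_scaledDir]
  rfl

end Weights

/-! ### Replacing L² norms of the inputs by L^∞ norms. -/

section WeightedEstimates

variable {n : ℕ}

theorem ennreal_add_sq_le (a b : ℝ≥0∞) : (a + b) ^ 2 ≤ 2 * a ^ 2 + 2 * b ^ 2 := by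
  induction a with
  | top => simp
  | coe a =>
    induction b with
    | top => simp
    | coe b =>
      norm_cast
      rw [← NNReal.coe_le_coe]
      push_cast
      nlinarith [sq_nonneg ((a : ℝ) - b)]

theorem enorm_weight_sq_le {s : ℝ} {c : Rn n} {j : Fin n} {x : Rn n}
    (h : |s * (x j - c j)| ≤ 1) : ‖weight s c j x‖ₑ ^ 2 ≤ 64 := by
  have h1 : ‖weight s c j x‖ ^ 2 ≤ 64 := by
    rw [norm_weight_sq]
    have h2 : (s * (x j - c j)) ^ 2 ≤ 1 := by
      rw [← sq_abs]; exact pow_le_one₀ (abs_nonneg _) h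
    -- The true bound is 1 + 4π² < 41; the value 64 is only a convenient majorant.
    have h3 : Real.pi ^ 2 ≤ 3.15 ^ 2 := by
      have := Real.pi_lt_d2
      gcongr
    have : (2 * Real.pi * s * (x j - c j)) ^ 2 = 4 * Real.pi ^ 2 * (s * (x j - c j)) ^ 2 := by ring
    rw [this]
    nlinarith [sq_nonneg Real.pi, sq_nonneg (s * (x j - c j))]
  rw [← ofReal_norm, ← ENNReal.ofReal_pow (norm_nonneg _)]
  exact (ENNReal.ofReal_le_ofReal h1).trans (by simp)

theorem Amplitude.continuous_multiplierOp {s B A : ℝ} {k : ℕ} {a : Rn n × Rn n × Rn n → ℂ}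
    (ha : Amplitude s B k A a) (f g : SchwartzMap (Rn n) ℂ) :
    Continuous fun y : Rn n × Rn n => multiplierOp a y.1 f g y.2 :=
  BilinearPDO.continuous_multiplierOp ha.smooth.continuous (fun q => (ha.bound q).norm_le) f g

theorem Amplitude.measurable_multiplierOp {s B A : ℝ} {k : ℕ} {a : Rn n × Rn n × Rn n → ℂ}
    (ha : Amplitude s B k A a) (z : Rn n) (f g : SchwartzMap (Rn n) ℂ) :
    Measurable fun x => ‖multiplierOp a z f g x‖ₑ ^ 2 :=
  ((ha.continuous_multiplierOp f g).comp
    (continuous_const.prodMk continuous_id)).enorm.measurable.pow_const 2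

/-- The constant is 130 = 2 · 64 + 2, from (a+b)² ≤ 2a² + 2b² and the bound 64 for the squared
weight. -/
theorem lintegral_weight_step {ν : Measure (Rn n)} {s : ℝ} {c : Rn n} {j : Fin n}
    (hν : ∀ᵐ x ∂ν, ∀ j, |s * (x j - c j)| ≤ 1) {T X Y : Rn n → ℂ} {C D : ℝ≥0∞}
    (hT : ∀ x, T x = weight s c j x * X x + Y x) (hY : Measurable fun x => ‖Y x‖ₑ ^ 2)
    (hX' : ∫⁻ x, ‖X x‖ₑ ^ 2 ∂ν ≤ C * D) (hY' : ∫⁻ x, ‖Y x‖ₑ ^ 2 ∂ν ≤ C * D) :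
    ∫⁻ x, ‖T x‖ₑ ^ 2 ∂ν ≤ (130 * C) * D := by
  calc ∫⁻ x, ‖T x‖ₑ ^ 2 ∂ν ≤ ∫⁻ x, (128 * ‖X x‖ₑ ^ 2 + 2 * ‖Y x‖ₑ ^ 2) ∂ν := by
        refine lintegral_mono_ae ?_
        filter_upwards [hν] with x hx
        rw [hT]
        refine (pow_le_pow_left' (enorm_add_le _ _) 2).trans ((ennreal_add_sq_le _ _).trans ?_)
        rw [enorm_mul, mul_pow, ← mul_assoc]
        gcongr
        calc (2 : ℝ≥0∞) * ‖weight s c j x‖ₑ ^ 2 ≤ 2 * 64 := by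
              gcongr; exact enorm_weight_sq_le (hx j)
          _ = 128 := by norm_num
    _ = 128 * ∫⁻ x, ‖X x‖ₑ ^ 2 ∂ν + 2 * ∫⁻ x, ‖Y x‖ₑ ^ 2 ∂ν := by
        rw [lintegral_add_right _ (hY.const_mul _), lintegral_const_mul' _ _ (by simp),
          lintegral_const_mul' _ _ (by simp)]
    _ ≤ 128 * (C * D) + 2 * (C * D) := by gcongr
    _ = (130 * C) * D := by ring

/-- Division of a Schwartz function by several weights. -/
def divWeights (s : ℝ) (c : Rn n) (f : SchwartzMap (Rn n) ℂ) (L : List (Fin n)) :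
    SchwartzMap (Rn n) ℂ :=
  L.foldl (divWeight s c) f

theorem divWeights_cons (s : ℝ) (c : Rn n) (f : SchwartzMap (Rn n) ℂ) (j : Fin n)
    (L : List (Fin n)) : divWeights s c f (j :: L) = divWeights s c (divWeight s c f j) L := rfl

/-- Iterate the transfer identities, spending one derivative of the amplitude per weight. The
measure ν is left general so that one induction serves both Lebesgue measure on a cube and a Dirac
mass. -/
theorem weighted_bound {ν : Measure (Rn n)} {s B : ℝ} {c z : Rn n} {K : ℝ≥0∞}
    (hν : ∀ᵐ x ∂ν, ∀ j, |s * (x j - c j)| ≤ 1)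
    (hK : ∀ (a : Rn n × Rn n × Rn n → ℂ) (A : ℝ) (F G : SchwartzMap (Rn n) ℂ),
      Amplitude s B 0 A a → ∫⁻ x, ‖multiplierOp a z F G x‖ₑ ^ 2 ∂ν ≤
        K * ENNReal.ofReal A ^ 2 * (normSq F * normSq G))
    (L L' : List (Fin n)) (a : Rn n × Rn n × Rn n → ℂ) (A : ℝ) (f g : SchwartzMap (Rn n) ℂ)
    (ha : Amplitude s B (L.length + L'.length) A a) :
    ∫⁻ x, ‖multiplierOp a z f g x‖ₑ ^ 2 ∂ν ≤
      130 ^ (L.length + L'.length) * (K * ENNReal.ofReal A ^ 2 *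
        (normSq (divWeights s c f L) * normSq (divWeights s c g L'))) := by
  induction L generalizing a f with
  | nil =>
    induction L' generalizing a g with
    | nil => simpa [divWeights] using hK a A f g ha
    | cons j L' ih =>
      have ha' : Amplitude s B (L'.length + 1) A a := by simpa using ha
      have h := lintegral_weight_step hν (multiplierOp_divWeight_right ha' z c j f g)
        ((ha'.deriv _).measurable_multiplierOp z _ _)
        (ih _ _ (ha'.of_le (by simp))) (ih _ _ ((ha'.deriv _).of_le (by simp)))
      refine h.trans (le_of_eq ?_)
      simp only [List.length_nil, List.length_cons, zero_add, divWeights_cons]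
      rw [← pow_succ']
  | cons j L ih =>
    have ha' : Amplitude s B (L.length + L'.length + 1) A a := by
      convert ha using 1
      simp only [List.length_cons]
      omega
    have h := lintegral_weight_step hν (multiplierOp_divWeight_left ha' z c j f g)
      ((ha'.deriv _).measurable_multiplierOp z _ _)
      (ih _ _ (ha'.of_le (by simp))) (ih _ _ (ha'.deriv _))
    refine h.trans (le_of_eq ?_)
    simp only [List.length_cons, divWeights_cons]
    rw [← pow_succ', show L.length + L'.length + 1 = L.length + 1 + L'.length by omega]

theorem divWeights_apply (s : ℝ) (c : Rn n) (f : SchwartzMap (Rn n) ℂ) (L : List (Fin n))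
    (y : Rn n) : divWeights s c f L y =
      (L.map fun j => (weight s c j y)⁻¹).prod * f y := by
  induction L generalizing f with
  | nil => simp [divWeights]
  | cons j L ih =>
    rw [divWeights_cons, ih, divWeight_apply, List.map_cons, List.prod_cons]
    ring

theorem integral_weight_one {s : ℝ} (hs : 0 < s) (c : ℝ) :
    Integrable (fun t : ℝ => (1 + (2 * Real.pi * s * (t - c)) ^ 2)⁻¹) ∧
      ∫ t : ℝ, (1 + (2 * Real.pi * s * (t - c)) ^ 2)⁻¹ = (2 * s)⁻¹ := by
  have hne : 2 * Real.pi * s ≠ 0 := by positivity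
  constructor
  · exact (integrable_inv_one_add_sq.comp_mul_left' hne).comp_sub_right c
  · rw [integral_sub_right_eq_self (fun t : ℝ => (1 + (2 * Real.pi * s * t) ^ 2)⁻¹) c,
      Measure.integral_comp_mul_left (fun t : ℝ => (1 + t ^ 2)⁻¹), integral_univ_inv_one_add_sq,
      abs_of_pos (by positivity), smul_eq_mul]
    field_simp

theorem lintegral_weight_prod {s : ℝ} (hs : 0 < s) (c : Rn n) :
    ∫⁻ y : Rn n, ENNReal.ofReal (∏ j, (1 + (2 * Real.pi * s * (y j - c j)) ^ 2)⁻¹) =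
      ENNReal.ofReal (((2 * s)⁻¹) ^ n) := by
  have hmp := EuclideanSpace.volume_preserving_symm_measurableEquiv_toLp (Fin n)
  have h1 : ∫⁻ y : Rn n, ENNReal.ofReal (∏ j, (1 + (2 * Real.pi * s * (y j - c j)) ^ 2)⁻¹) =
      ∫⁻ y : Fin n → ℝ, ENNReal.ofReal (∏ j, (1 + (2 * Real.pi * s * (y j - c j)) ^ 2)⁻¹) := by
    rw [← hmp.lintegral_comp_emb (MeasurableEquiv.measurableEmbedding _)]
    rfl
  have hint : Integrable fun y : Fin n → ℝ =>
      ∏ j, (1 + (2 * Real.pi * s * (y j - c j)) ^ 2)⁻¹ :=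
    Integrable.fintype_prod (f := fun j t => (1 + (2 * Real.pi * s * (t - c j)) ^ 2)⁻¹)
      fun j => (integral_weight_one hs (c j)).1
  rw [h1, ← ofReal_integral_eq_lintegral_ofReal hint
    (Filter.Eventually.of_forall fun y => Finset.prod_nonneg fun j _ => by positivity)]
  congr 1
  rw [integral_fintype_prod_volume_eq_prod
    (fun (j : Fin n) (t : ℝ) => (1 + (2 * Real.pi * s * (t - c j)) ^ 2)⁻¹)]
  simp [(integral_weight_one hs _).2]

/-- One weight per coordinate suffices, because (1 + (2πst)²)⁻¹ is already integrable on the line,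
with integral 1/(2s). -/
theorem normSq_divWeights_le {s : ℝ} (hs : 0 < s) (c : Rn n) (f : SchwartzMap (Rn n) ℂ) :
    normSq (divWeights s c f (List.finRange n)) ≤
      ENNReal.ofReal (((2 * s)⁻¹) ^ n) * eLpNorm f ∞ volume ^ 2 := by
  rw [← lintegral_weight_prod hs c, mul_comm, ← lintegral_const_mul']
  swap
  · exact ENNReal.pow_ne_top (f.memLp ∞ volume).eLpNorm_ne_top
  unfold normSq
  refine lintegral_mono_ae ?_
  have hess : ∀ᵐ y ∂(volume : Measure (Rn n)), ‖f y‖ₑ ≤ eLpNorm f ∞ volume := by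
    rw [eLpNorm_exponent_top]
    exact enorm_ae_le_eLpNormEssSup f volume
  filter_upwards [hess] with y hy
  rw [divWeights_apply, enorm_mul, mul_pow, mul_comm]
  gcongr
  rw [← ofReal_norm, ← ENNReal.ofReal_pow (norm_nonneg _)]
  refine ENNReal.ofReal_le_ofReal (le_of_eq ?_)
  rw [← Fin.prod_univ_def, norm_prod, ← Finset.prod_pow]
  simp [norm_weight_sq]

end WeightedEstimates

/-! ### Local L² bounds: frozen symbol, then restoration of its dependence on x. -/

section FrozenVariable

open scoped FourierTransform

variable {n : ℕ}

theorem measurableSet_cube (c : Rn n) (l : ℝ) : MeasurableSet (cube c l) := by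
  have : cube c l = ⋂ i, {x : Rn n | c i ≤ x i ∧ x i ≤ c i + l} := by
    ext x; simp [cube]
  rw [this]
  refine MeasurableSet.iInter fun i => ?_
  have hi : Continuous fun x : Rn n => x i := by fun_prop
  exact ((isClosed_le continuous_const hi).inter (isClosed_le hi continuous_const)).measurableSet

/-- The constant in the weighted estimates at the scale `s`. -/
def weightConst (n : ℕ) (s A : ℝ) : ℝ≥0∞ :=
  130 ^ (n + n) * (ENNReal.ofReal A ^ 2 * ENNReal.ofReal (((2 * s)⁻¹) ^ n) ^ 2)

theorem weight_estimate {K M N F G W C D : ℝ≥0∞} (hM : M ≤ W * F) (hN : N ≤ W * G) :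
    D * (K * C * (M * N)) ≤ K * (D * (C * W ^ 2)) * (F * G) := by
  calc D * (K * C * (M * N)) ≤ D * (K * C * ((W * F) * (W * G))) := by gcongr
    _ = _ := by ring

theorem Amplitude.frozen_bound {s B A : ℝ} (hs : 0 < s) {a : Rn n × Rn n × Rn n → ℂ}
    (ha : Amplitude s B (n + n) A a) (c z : Rn n) (f g : SchwartzMap (Rn n) ℂ) :
    ∫⁻ x in cube c s⁻¹, ‖multiplierOp a z f g x‖ₑ ^ 2 ≤
      volume (Metric.closedBall (0 : Rn n) B) * weightConst n s A *
        (eLpNorm f ∞ volume ^ 2 * eLpNorm g ∞ volume ^ 2) := by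
  have h := weighted_bound (ν := volume.restrict (cube c s⁻¹)) (s := s) (B := B) (c := c) (z := z)
    (K := volume (Metric.closedBall (0 : Rn n) B)) ?_ ?_ (List.finRange n) (List.finRange n) a A
    f g (by simpa using ha)
  · refine h.trans ?_
    simp only [List.length_finRange]
    exact weight_estimate (normSq_divWeights_le hs c f) (normSq_divWeights_le hs c g)
  · filter_upwards [ae_restrict_mem (measurableSet_cube c s⁻¹)] with x hx j
    obtain ⟨h1, h2⟩ := hx j
    rw [abs_le]
    have : s * s⁻¹ = 1 := mul_inv_cancel₀ hs.ne'
    constructor <;> nlinarith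
  · intro a A F G ha
    exact (setLIntegral_le_lintegral _ _).trans (ha.normSq_bound z F G)

/-- The weighted estimate for the Dirac mass at x, with the weights centred at x itself. -/
theorem Amplitude.sup_bound {s B A : ℝ} (hs : 0 < s) {a : Rn n × Rn n × Rn n → ℂ}
    (ha : Amplitude s B (n + n) A a) (z x : Rn n) (f g : SchwartzMap (Rn n) ℂ) :
    ‖multiplierOp a z f g x‖ₑ ^ 2 ≤
      volume (Metric.closedBall (0 : Rn n) B) ^ 2 * weightConst n s A *
        (eLpNorm f ∞ volume ^ 2 * eLpNorm g ∞ volume ^ 2) := by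
  have h := weighted_bound (ν := Measure.dirac x) (s := s) (B := B) (c := x) (z := z)
    (K := volume (Metric.closedBall (0 : Rn n) B) ^ 2) ?_ ?_ (List.finRange n) (List.finRange n) a A
    f g (by simpa using ha)
  · rw [lintegral_dirac] at h
    refine h.trans ?_
    simp only [List.length_finRange]
    exact weight_estimate (normSq_divWeights_le hs x f) (normSq_divWeights_le hs x g)
  · rw [ae_dirac_eq]
    simp
  · intro a A F G ha
    rw [lintegral_dirac]
    exact ha.pointwise_bound z F G x

/-- One-dimensional Sobolev inequality: |h(t)| ≤ |h(r)| + ∫|h'| for every r in the interval; square,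
integrate in r, and apply Cauchy-Schwarz to ∫|h'|. -/
theorem enorm_sq_mul_le_lintegral {h h' : ℝ → ℂ} (hd : ∀ t, HasDerivAt h (h' t) t)
    (hc : Continuous h') {c l t : ℝ} (ht : t ∈ Set.Icc c (c + l)) :
    ENNReal.ofReal l * ‖h t‖ₑ ^ 2 ≤ 2 * (∫⁻ r in Set.Icc c (c + l), ‖h r‖ₑ ^ 2) +
      2 * ENNReal.ofReal l ^ 2 * ∫⁻ r in Set.Icc c (c + l), ‖h' r‖ₑ ^ 2 := by
  have hder : deriv h = h' := funext fun r => (hd r).deriv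
  have hC1 : ContDiff ℝ 1 h := contDiff_one_iff_deriv.2
    ⟨fun r => (hd r).differentiableAt, by rw [hder]; exact hc⟩
  set J := ∫⁻ r in Set.Icc c (c + l), ‖h' r‖ₑ with hJ
  have hvol : volume (Set.Icc c (c + l)) = ENNReal.ofReal l := by simp
  have h1 : ∀ r ∈ Set.Icc c (c + l), ‖h t‖ₑ ≤ ‖h r‖ₑ + J := by
    intro r hr
    have key : ∀ {p q : ℝ}, p ∈ Set.Icc c (c + l) → q ∈ Set.Icc c (c + l) → p ≤ q →
        ‖h q - h p‖ₑ ≤ J := fun {p q} hp hq hpq => by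
      refine (enorm_sub_le_lintegral_deriv_of_contDiffOn_Icc hC1.contDiffOn hpq).trans ?_
      rw [hder]
      exact lintegral_mono_set (Set.Icc_subset_Icc hp.1 hq.2)
    have h2 : ‖h t - h r‖ₑ ≤ J := by
      rcases le_total r t with h | h
      · exact key hr ht h
      · rw [← neg_sub, enorm_neg]; exact key ht hr h
    calc ‖h t‖ₑ = ‖h r + (h t - h r)‖ₑ := by congr 1; ring
      _ ≤ ‖h r‖ₑ + ‖h t - h r‖ₑ := enorm_add_le _ _
      _ ≤ _ := by gcongr
  have hJ2 : J ^ 2 ≤ ENNReal.ofReal l * ∫⁻ r in Set.Icc c (c + l), ‖h' r‖ₑ ^ 2 := by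
    have := lintegral_mul_sq_le (μ := volume.restrict (Set.Icc c (c + l))) (f := fun _ => 1)
      (g := fun r => ‖h' r‖ₑ) aemeasurable_const hc.enorm.aemeasurable
    simpa [hJ] using this
  have hmeas : Measurable fun r => 2 * ‖h r‖ₑ ^ 2 :=
    (hC1.continuous.enorm.measurable.pow_const 2).const_mul _
  calc ENNReal.ofReal l * ‖h t‖ₑ ^ 2 = ∫⁻ r in Set.Icc c (c + l), ‖h t‖ₑ ^ 2 := by
        rw [setLIntegral_const, hvol, mul_comm]
    _ ≤ ∫⁻ r in Set.Icc c (c + l), (2 * ‖h r‖ₑ ^ 2 + 2 * J ^ 2) := by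
        refine setLIntegral_mono' measurableSet_Icc fun r hr => ?_
        exact (pow_le_pow_left' (h1 r hr) 2).trans (ennreal_add_sq_le _ _)
    _ = 2 * (∫⁻ r in Set.Icc c (c + l), ‖h r‖ₑ ^ 2) + 2 * J ^ 2 * ENNReal.ofReal l := by
        rw [lintegral_add_left hmeas, setLIntegral_const, hvol, lintegral_const_mul' _ _ (by simp)]
    _ ≤ _ := by
        refine add_le_add le_rfl ?_
        calc 2 * J ^ 2 * ENNReal.ofReal l ≤ 2 * (ENNReal.ofReal l *
              ∫⁻ r in Set.Icc c (c + l), ‖h' r‖ₑ ^ 2) * ENNReal.ofReal l := by gcongr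
          _ = _ := by ring

/-- The amplitude of the derivative of `t ↦ multiplierOp a (z + t h) f g (x + t k)`. -/
def pathDeriv (h k : Rn n) (a : Rn n × Rn n × Rn n → ℂ) (q : Rn n × Rn n × Rn n) : ℂ :=
  2 * Real.pi * Complex.I * (inner ℝ k (q.2.1 + q.2.2) : ℝ) * a q + dirDeriv (h, 0, 0) a q

/-- The frozen point and the output point move independently: k = 0 is used for unfreezing, h = k
for differentiating along the diagonal. -/
theorem hasDerivAt_multiplierOp {a : Rn n × Rn n × Rn n → ℂ} (ha : Smooth a) {A A' : ℝ}
    (hA : ∀ q, ‖a q‖ ≤ A) {h k : Rn n} (hA' : ∀ q, ‖pathDeriv h k a q‖ ≤ A') (z x : Rn n)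
    (f g : SchwartzMap (Rn n) ℂ) (t : ℝ) :
    HasDerivAt (fun t : ℝ => multiplierOp a (z + t • h) f g (x + t • k))
      (multiplierOp (pathDeriv h k a) (z + t • h) f g (x + t • k)) t := by
  have hcont : Continuous (pathDeriv h k a) := by
    have := (ha.dirDeriv (h, 0, 0)).continuous
    have := ha.continuous
    unfold pathDeriv
    have h1 : Continuous fun q : Rn n × Rn n × Rn n => ((inner ℝ k (q.2.1 + q.2.2) : ℝ) : ℂ) :=
      Complex.continuous_ofReal.comp (by fun_prop)
    fun_prop
  unfold multiplierOp
  refine (hasDerivAt_integral_of_dominated_loc_of_deriv_le (s := Set.univ)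
    (F' := fun (t : ℝ) (p : Rn n × Rn n) =>
      (Real.fourierChar (inner ℝ (x + t • k) (p.1 + p.2)) : ℂ) * pathDeriv h k a (z + t • h, p) *
        ((𝓕 f : SchwartzMap (Rn n) ℂ) p.1 * (𝓕 g : SchwartzMap (Rn n) ℂ) p.2))
    (bound := fun p => A' *
      ‖(𝓕 f : SchwartzMap (Rn n) ℂ) p.1 * (𝓕 g : SchwartzMap (Rn n) ℂ) p.2‖)
    Filter.univ_mem ?_ ?_ ?_ ?_ ((integrable_fourier_prod f g).norm.const_mul A') ?_).2
  · exact Filter.Eventually.of_forall fun t =>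
      (integrable_multiplierOp ha.continuous _ (fun p => hA _) f g _).aestronglyMeasurable
  · exact integrable_multiplierOp ha.continuous _ (fun p => hA _) f g _
  · exact (integrable_multiplierOp hcont _ (fun p => hA' _) f g _).aestronglyMeasurable
  · refine Filter.Eventually.of_forall fun p t _ => ?_
    rw [norm_mul, norm_mul, Circle.norm_coe, one_mul]
    gcongr
    exact hA' _
  · refine Filter.Eventually.of_forall fun p t _ => ?_
    have h1 : HasDerivAt (fun t : ℝ => (inner ℝ (x + t • k) (p.1 + p.2) : ℝ))
        (inner ℝ k (p.1 + p.2)) t := by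
      have := (((hasDerivAt_id t).smul_const k).const_add x).inner ℝ
        (hasDerivAt_const t (p.1 + p.2))
      simpa using this
    have h2 := (Real.hasDerivAt_fourierChar (inner ℝ (x + t • k) (p.1 + p.2))).scomp t h1
    have h3 : HasDerivAt (fun t : ℝ => a (z + t • h, p)) (dirDeriv (h, 0, 0) a (z + t • h, p)) t := by
      have hγ : HasDerivAt (fun t : ℝ => (z + t • h, p)) (h, (0 : Rn n × Rn n)) t := by
        refine HasDerivAt.prodMk ?_ (hasDerivAt_const t p)
        simpa using ((hasDerivAt_id t).smul_const h).const_add z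
      exact (ha.differentiable (z + t • h, p)).hasFDerivAt.comp_hasDerivAt t hγ
    refine ((h2.mul h3).mul_const _).congr_deriv ?_
    simp only [pathDeriv, Function.comp_apply, Complex.real_smul]
    ring

theorem multiplierOp_const_mul (b : ℂ) (a : Rn n × Rn n × Rn n → ℂ) (z : Rn n)
    (f g : SchwartzMap (Rn n) ℂ) (x : Rn n) :
    multiplierOp (fun q => b * a q) z f g x = b * multiplierOp a z f g x := by
  unfold multiplierOp
  rw [← integral_const_mul]
  congr 1
  funext p
  ring

/-- The point with the coordinates of `x` for the indices in `L` and those of `z` otherwise. -/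
def mergeCoord (L : List (Fin n)) (x z : Rn n) : Rn n :=
  WithLp.toLp 2 fun i => if i ∈ L then x i else z i

theorem mergeCoord_finRange (x z : Rn n) : mergeCoord (List.finRange n) x z = x := by
  ext i
  simp [mergeCoord]

theorem mergeCoord_cons {L : List (Fin n)} {j : Fin n} (hj : j ∉ L) (x z : Rn n) (t : ℝ) :
    mergeCoord L x (mergeCoord [j] (t • stdVec j) z) =
      (mergeCoord L x z - (z j) • stdVec j) + t • stdVec j := by
  ext i
  by_cases hij : i = j
  · subst hij; simp [mergeCoord, hj, stdVec]
  · by_cases hi : i ∈ L <;> simp [mergeCoord, hi, hij, stdVec]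

theorem mergeCoord_cons_self {L : List (Fin n)} {j : Fin n} (hj : j ∉ L) (x z : Rn n) :
    mergeCoord (j :: L) x z = mergeCoord L x (mergeCoord [j] ((x j) • stdVec j) z) := by
  ext i
  by_cases hij : i = j
  · subst hij; simp [mergeCoord, hj, stdVec]
  · by_cases hi : i ∈ L <;> simp [mergeCoord, hi, hij]

theorem continuous_mergeCoord (L : List (Fin n)) :
    Continuous fun y : Rn n × Rn n => mergeCoord L y.1 y.2 := by
  unfold mergeCoord
  refine (PiLp.continuous_toLp 2 _).comp (continuous_pi fun i => ?_)
  by_cases hi : i ∈ L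
  · simp only [hi, if_true]; fun_prop
  · simp only [hi, if_false]; fun_prop

/-- To replace z_j by x_j, apply the Sobolev inequality in a dummy r over the j-th side of the cube,
which contains x_j. Tonelli then puts r outside, where for each r the induction hypothesis applies
to a and to s⁻¹∂_{x_j}a. Each coordinate costs one derivative and a factor 4 = 2 + 2. -/
theorem unfreeze_bound {s B A : ℝ} (hs : 0 < s) {k : ℕ} {K : ℝ≥0∞} {c : Rn n}
    {f g : SchwartzMap (Rn n) ℂ}
    (hK : ∀ (a : Rn n × Rn n × Rn n → ℂ) (z : Rn n), Amplitude s B k A a →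
      ∫⁻ x in cube c s⁻¹, ‖multiplierOp a z f g x‖ₑ ^ 2 ≤ K)
    (L : List (Fin n)) (hL : L.Nodup) (a : Rn n × Rn n × Rn n → ℂ)
    (ha : Amplitude s B (L.length + k) A a) (z : Rn n) :
    ∫⁻ x in cube c s⁻¹, ‖multiplierOp a (mergeCoord L x z) f g x‖ₑ ^ 2 ≤ 4 ^ L.length * K := by
  induction L generalizing a z with
  | nil =>
    simp only [List.length_nil, zero_add] at ha
    simpa [mergeCoord] using hK a z ha
  | cons j L ih =>
    obtain ⟨hjL, hL⟩ := List.nodup_cons.1 hL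
    have ha1 : Amplitude s B (L.length + k + 1) A a := by
      convert ha using 1
      simp only [List.length_cons]
      omega
    have ha0 := ha1.of_le (Nat.le_succ (L.length + k))
    set a' := dirDeriv (scaledDir s⁻¹ s (Sum.inl j)) a with ha'
    have had := ha1.deriv (Sum.inl j)
    set I : Set ℝ := Set.Icc (c j) (c j + s⁻¹) with hI
    have hsinv : (0 : ℝ) < s⁻¹ := inv_pos.2 hs
    have hpath : pathDeriv (stdVec j) 0 a = fun q => (s : ℂ) * a' q := by
      funext q
      simp only [pathDeriv, inner_zero_left, ha', scaledDir]
      rw [dirDeriv_smul_left]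
      push_cast
      rw [mul_inv_cancel_left₀ (by exact_mod_cast hs.ne')]
      simp
    have hpt : ∀ x ∈ cube c s⁻¹,
        ENNReal.ofReal s⁻¹ * ‖multiplierOp a (mergeCoord (j :: L) x z) f g x‖ₑ ^ 2 ≤
        2 * (∫⁻ r in I, ‖multiplierOp a
          (mergeCoord L x (mergeCoord [j] (r • stdVec j) z)) f g x‖ₑ ^ 2) +
        2 * ∫⁻ r in I, ‖multiplierOp a'
          (mergeCoord L x (mergeCoord [j] (r • stdVec j) z)) f g x‖ₑ ^ 2 := by
      intro x hx
      set y := mergeCoord L x z - (z j) • stdVec j with hy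
      have hder := fun t => hasDerivAt_multiplierOp ha1.smooth (fun q => (ha1.bound q).norm_le)
        (h := stdVec j) (k := 0) (A' := s * A) (fun q => by
          rw [hpath, norm_mul, Complex.norm_real, Real.norm_of_nonneg hs.le]
          gcongr
          exact (had.bound q).norm_le) y x f g t
      simp only [smul_zero, add_zero, hpath, multiplierOp_const_mul] at hder
      have hcont : Continuous fun t : ℝ => (s : ℂ) * multiplierOp a' (y + t • stdVec j) f g x :=
        continuous_const.mul ((had.continuous_multiplierOp f g).comp
          (f := fun t : ℝ => (y + t • stdVec j, x)) (by fun_prop))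
      have h1 := enorm_sq_mul_le_lintegral hder hcont (t := x j) (hx j)
      rw [mergeCoord_cons_self hjL]
      simp only [mergeCoord_cons hjL, ← hy]
      refine h1.trans (le_of_eq ?_)
      congr 1
      have e : ∀ r : ℝ, ‖(s : ℂ) * multiplierOp a' (y + r • stdVec j) f g x‖ₑ ^ 2 =
          ENNReal.ofReal s ^ 2 * ‖multiplierOp a' (y + r • stdVec j) f g x‖ₑ ^ 2 := fun r => by
        rw [enorm_mul, mul_pow, ← ofReal_norm, Complex.norm_real, Real.norm_of_nonneg hs.le]
      simp only [e]
      -- The squared side length s⁻² from Sobolev cancels the s² of the unnormalised derivative, so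
      -- the estimate is scale free.
      rw [lintegral_const_mul' _ _ (by simp), ← mul_assoc, mul_assoc 2, ← mul_pow,
        ← ENNReal.ofReal_mul hsinv.le, inv_mul_cancel₀ hs.ne', ENNReal.ofReal_one, one_pow, mul_one]
    have hswap : ∀ b : Rn n × Rn n × Rn n → ℂ, Amplitude s B (L.length + k) A b →
        Measurable (fun x => ∫⁻ r in I, ‖multiplierOp b
          (mergeCoord L x (mergeCoord [j] (r • stdVec j) z)) f g x‖ₑ ^ 2) ∧
        ∫⁻ x in cube c s⁻¹, ∫⁻ r in I, ‖multiplierOp b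
          (mergeCoord L x (mergeCoord [j] (r • stdVec j) z)) f g x‖ₑ ^ 2 ≤
        ENNReal.ofReal s⁻¹ * (4 ^ L.length * K) := by
      intro b hb
      have hm : Measurable (Function.uncurry fun (x : Rn n) (r : ℝ) => ‖multiplierOp b
          (mergeCoord L x (mergeCoord [j] (r • stdVec j) z)) f g x‖ₑ ^ 2) := by
        have h1 : Continuous fun y : Rn n × ℝ => mergeCoord [j] (y.2 • stdVec j) z :=
          (continuous_mergeCoord [j]).comp (f := fun y : Rn n × ℝ => (y.2 • stdVec j, z))
            (by fun_prop)
        have h2 : Continuous fun y : Rn n × ℝ =>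
            mergeCoord L y.1 (mergeCoord [j] (y.2 • stdVec j) z) :=
          (continuous_mergeCoord L).comp (continuous_fst.prodMk h1)
        exact ((hb.continuous_multiplierOp f g).comp
          (h2.prodMk continuous_fst)).enorm.measurable.pow_const 2
      refine ⟨hm.lintegral_prod_right', ?_⟩
      rw [lintegral_lintegral_swap hm.aemeasurable]
      calc _ ≤ ∫⁻ _ in I, 4 ^ L.length * K := lintegral_mono fun r => ih hL b hb _
        _ = _ := by rw [setLIntegral_const]; simp [hI, mul_comm]
    obtain ⟨hm1, hb1⟩ := hswap a ha0
    obtain ⟨hm2, hb2⟩ := hswap a' had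
    have hfin : ENNReal.ofReal s⁻¹ * ∫⁻ x in cube c s⁻¹,
        ‖multiplierOp a (mergeCoord (j :: L) x z) f g x‖ₑ ^ 2 ≤
        ENNReal.ofReal s⁻¹ * (4 ^ (L.length + 1) * K) := by
      rw [← lintegral_const_mul' _ _ (by simp)]
      calc _ ≤ ∫⁻ x in cube c s⁻¹, (2 * (∫⁻ r in I, ‖multiplierOp a
          (mergeCoord L x (mergeCoord [j] (r • stdVec j) z)) f g x‖ₑ ^ 2) +
        2 * ∫⁻ r in I, ‖multiplierOp a'
          (mergeCoord L x (mergeCoord [j] (r • stdVec j) z)) f g x‖ₑ ^ 2) :=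
            setLIntegral_mono' (measurableSet_cube _ _) hpt
        _ ≤ 2 * (ENNReal.ofReal s⁻¹ * (4 ^ L.length * K)) +
            2 * (ENNReal.ofReal s⁻¹ * (4 ^ L.length * K)) := by
            rw [lintegral_add_left (hm1.const_mul _), lintegral_const_mul' _ _ (by simp),
              lintegral_const_mul' _ _ (by simp)]
            gcongr
        _ = _ := by ring
    exact (ENNReal.mul_le_mul_iff_right (by simpa using hs) (by simp)).1 hfin

theorem Amplitude.cube_bound {s B A : ℝ} (hs : 0 < s) {a : Rn n × Rn n × Rn n → ℂ}
    (ha : Amplitude s B (n + (n + n)) A a) (c : Rn n) (f g : SchwartzMap (Rn n) ℂ) :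
    ∫⁻ x in cube c s⁻¹, ‖multiplierOp a x f g x‖ₑ ^ 2 ≤
      4 ^ n * (volume (Metric.closedBall (0 : Rn n) B) * weightConst n s A *
        (eLpNorm f ∞ volume ^ 2 * eLpNorm g ∞ volume ^ 2)) := by
  have h := unfreeze_bound hs (fun a z ha => ha.frozen_bound hs c z f g) (List.finRange n)
    (List.nodup_finRange n) a (by simpa using ha) 0
  simpa only [mergeCoord_finRange, List.length_finRange] using h

end FrozenVariable

/-! ### The two basic estimates for a dyadic piece. -/

section DyadicEstimates

open scoped FourierTransform

variable {n : ℕ}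

theorem DerivBound.const {V ι : Type*} [NormedAddCommGroup V] [NormedSpace ℝ V] {v : ι → V} {k : ℕ}
    {A : ℝ} {b : ℂ} (hb : ‖b‖ ≤ A) (p : V) : DerivBound v k A (fun _ => b) p := by
  cases k with
  | zero => exact hb
  | succ k =>
    refine ⟨hb, fun d => ?_⟩
    have : dirDeriv (v d) (fun _ : V => b) = fun _ => 0 := by
      funext q; simp [dirDeriv]
    rw [this]
    exact DerivBound.zero_fun ((norm_nonneg _).trans hb)

theorem DerivBound.clm {V ι : Type*} [NormedAddCommGroup V] [NormedSpace ℝ V] {v : ι → V} {k : ℕ}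
    {A : ℝ} (ℓ : V →L[ℝ] ℂ) {p : V} (hp : ‖ℓ p‖ ≤ A) (hv : ∀ d, ‖ℓ (v d)‖ ≤ A) :
    DerivBound v k A (fun q => ℓ q) p := by
  cases k with
  | zero => exact hp
  | succ k =>
    refine ⟨hp, fun d => ?_⟩
    have : dirDeriv (v d) (fun q => ℓ q) = fun _ => ℓ (v d) := by
      funext q; simp [dirDeriv]
    rw [this]
    exact DerivBound.const (hv d) p

theorem norm_stdVec (j : Fin n) : ‖(stdVec j : Rn n)‖ = 1 := by simp [stdVec]

theorem dirDeriv_x_eq_sum {s : ℝ} (hs : 0 < s) (h : Rn n) (a : Rn n × Rn n × Rn n → ℂ) :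
    dirDeriv (h, 0, 0) a = fun q =>
      ∑ i, ((h i * s : ℝ) : ℂ) * dirDeriv (scaledDir s⁻¹ s (Sum.inl i)) a q := by
  funext q
  have hh : (h, (0 : Rn n), (0 : Rn n)) =
      ∑ i, (h i * s) • (scaledDir s⁻¹ s (Sum.inl i) : Rn n × Rn n × Rn n) := by
    have e : h = ∑ i, h i • (stdVec i : Rn n) := by
      ext j
      simp [stdVec, Finset.sum_apply, Pi.single_apply]
    have e2 : ∀ i, (h i * s) • (scaledDir s⁻¹ s (Sum.inl i) : Rn n × Rn n × Rn n) =
        (h i • stdVec i, 0, 0) := fun i => by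
      simp [scaledDir, smul_smul, mul_assoc, mul_inv_cancel₀ hs.ne']
    simp only [e2]
    refine Prod.ext ?_ (Prod.ext ?_ ?_)
    · simpa [Prod.fst_sum] using e
    · simp [Prod.snd_sum]
    · simp [Prod.snd_sum]
  simp only [dirDeriv]
  rw [hh, map_sum]
  refine Finset.sum_congr rfl fun i _ => ?_
  rw [map_smul, Complex.real_smul]

/-- Differentiating the phase costs |h · (ξ + η)| ≤ 2B‖h‖ on the support; differentiating the symbol
in x costs at most s|h_i| ≤ B‖h‖ per coordinate. These are the terms 2π · 2^k · 2 (with the Leibniz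
factor) and n of the constant. -/
theorem Amplitude.pathDeriv {s B A : ℝ} {k : ℕ} {a : Rn n × Rn n × Rn n → ℂ} (hs : 0 < s)
    (hsB : s ≤ B) (ha : Amplitude s B (k + 1) A a) (h : Rn n) :
    Amplitude s B k ((2 * Real.pi * 2 ^ k * 2 + n) * (B * ‖h‖) * A) (pathDeriv h h a) := by
  have hA0 : 0 ≤ A := (norm_nonneg _).trans (ha.bound 0).norm_le
  have hB0 : 0 ≤ B := hs.le.trans hsB
  let ℓ : (Rn n × Rn n × Rn n) →L[ℝ] ℂ := Complex.ofRealCLM.comp ((innerSL ℝ h).comp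
    ((ContinuousLinearMap.fst ℝ (Rn n) (Rn n) + ContinuousLinearMap.snd ℝ (Rn n) (Rn n)).comp
      (ContinuousLinearMap.snd ℝ (Rn n) (Rn n × Rn n))))
  have hℓ : ∀ q : Rn n × Rn n × Rn n, ℓ q = ((inner ℝ h (q.2.1 + q.2.2) : ℝ) : ℂ) := fun q => by
    simp [ℓ, inner_add_right]
  have hℓn : ∀ q : Rn n × Rn n × Rn n, ‖ℓ q‖ ≤ ‖h‖ * (‖q.2.1‖ + ‖q.2.2‖) := fun q => by
    rw [hℓ, Complex.norm_real]
    exact (norm_inner_le_norm _ _).trans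
      (mul_le_mul_of_nonneg_left (norm_add_le _ _) (norm_nonneg _))
  have hdef : BilinearPDO.pathDeriv h h a = fun q => (2 * Real.pi * Complex.I) * (ℓ q * a q) +
      ∑ i, ((h i * s : ℝ) : ℂ) * dirDeriv (scaledDir s⁻¹ s (Sum.inl i)) a q := by
    funext q
    simp only [BilinearPDO.pathDeriv, hℓ, dirDeriv_x_eq_sum hs h a]
    ring
  have hℓs : Smooth fun q => ℓ q := ℓ.contDiff
  have hd : ∀ i, Smooth fun q =>
      ((h i * s : ℝ) : ℂ) * dirDeriv (scaledDir s⁻¹ s (Sum.inl i)) a q := fun i =>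
    contDiff_const.mul (ha.smooth.dirDeriv _)
  have hsm1 : Smooth fun q => (2 * Real.pi * Complex.I) * (ℓ q * a q) :=
    contDiff_const.mul (hℓs.mul ha.smooth)
  have hsm2 : Smooth fun q =>
      ∑ i, ((h i * s : ℝ) : ℂ) * dirDeriv (scaledDir s⁻¹ s (Sum.inl i)) a q :=
    ContDiff.sum fun i _ => hd i
  have hzero : ∀ q : Rn n × Rn n × Rn n, ¬ (‖q.2.1‖ ≤ B ∧ ‖q.2.2‖ ≤ B) →
      BilinearPDO.pathDeriv h h a =ᶠ[nhds q] 0 := fun q hq => by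
    filter_upwards [(ha.eventuallyEq_zero hq).eventuallyEq_nhds] with p hp
    simp only [BilinearPDO.pathDeriv, dirDeriv_eq_zero_of_eventuallyEq hp, hp.self_of_nhds]
    simp
  refine ⟨?_, fun x ξ η hne => ?_, fun q => ?_⟩
  · rw [hdef]; exact hsm1.add hsm2
  · by_contra hcon
    exact hne (hzero (x, ξ, η) hcon).self_of_nhds
  by_cases hq : ‖q.2.1‖ ≤ B ∧ ‖q.2.2‖ ≤ B
  swap
  · exact (DerivBound.of_eventuallyEq_zero (hzero q hq)).mono (by positivity)
  have hBh : 0 ≤ B * ‖h‖ := by positivity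
  have h1 : DerivBound (scaledDir s⁻¹ s) k (2 * (B * ‖h‖)) (fun q => ℓ q) q := by
    refine DerivBound.clm ℓ ((hℓn q).trans ?_) fun d => (hℓn _).trans ?_
    · nlinarith [norm_nonneg h, hq.1, hq.2]
    · have : ‖(scaledDir s⁻¹ s d : Rn n × Rn n × Rn n).2.1‖ +
          ‖(scaledDir s⁻¹ s d : Rn n × Rn n × Rn n).2.2‖ ≤ B := by
        rcases d with i | i | i <;>
          simp [scaledDir, norm_smul, norm_stdVec, abs_of_pos hs, hsB, hB0]
      nlinarith [norm_nonneg h]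
  have h2 : DerivBound (scaledDir s⁻¹ s) k
      (‖(2 * Real.pi * Complex.I : ℂ)‖ * (2 ^ k * (2 * (B * ‖h‖) * A)))
      (fun q => (2 * Real.pi * Complex.I) * (ℓ q * a q)) q :=
    (h1.mul hℓs ha.smooth (ha.bound q).of_succ).const_mul (hℓs.mul ha.smooth) _
  have h3 : DerivBound (scaledDir s⁻¹ s) k (∑ i, ‖((h i * s : ℝ) : ℂ)‖ * A)
      (fun q => ∑ i, ((h i * s : ℝ) : ℂ) * dirDeriv (scaledDir s⁻¹ s (Sum.inl i)) a q) q :=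
    DerivBound.sum _ (fun i _ => hd i) fun i _ =>
      ((ha.bound q).2 (Sum.inl i)).const_mul (ha.smooth.dirDeriv _) _
  rw [hdef]
  refine (h2.add hsm1 hsm2 h3).mono ?_
  have h4 : ∑ i, ‖((h i * s : ℝ) : ℂ)‖ * A ≤ ∑ _i : Fin n, (B * ‖h‖) * A := by
    refine Finset.sum_le_sum fun i _ => ?_
    gcongr
    rw [Complex.norm_real, norm_mul, mul_comm, Real.norm_of_nonneg hs.le]
    gcongr
    exact PiLp.norm_apply_le h i
  have h5 : ‖(2 * Real.pi * Complex.I : ℂ)‖ = 2 * Real.pi := by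
    simp [abs_of_pos Real.pi_pos]
  rw [h5]
  simp only [Finset.sum_const, Finset.card_univ, Fintype.card_fin, nsmul_eq_mul] at h4
  linarith

/-- The dyadic pieces of the operator. -/
def dyadicOp (σ : Rn n × Rn n × Rn n → ℂ) (j : ℕ) (f g : SchwartzMap (Rn n) ℂ) (x : Rn n) : ℂ :=
  multiplierOp (dyadicPiece σ j) x f g x

theorem volume_closedBall_eq {B : ℝ} (hB : 0 ≤ B) : volume (Metric.closedBall (0 : Rn n) B) =
    ENNReal.ofReal (B ^ n) * volume (Metric.ball (0 : Rn n) 1) := by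
  rw [Measure.addHaar_closedBall _ _ hB]
  simp

/-- The identity R^m s^(-n) = R^(-n), squared: the point where the critical value m = -(1-ρ)n is
used. -/
theorem scale_identity {R ρ : ℝ} (hR : 0 < R) :
    (R ^ (-(1 - ρ) * (n : ℝ))) ^ 2 * (((R ^ ρ)⁻¹) ^ n) ^ 2 = ((R ^ n)⁻¹) ^ 2 := by
  rw [← mul_pow]
  congr 1
  rw [inv_pow, ← Real.rpow_natCast, ← Real.rpow_mul hR.le, ← Real.rpow_natCast R n,
    ← Real.rpow_neg hR.le, ← Real.rpow_neg hR.le, ← Real.rpow_add hR]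
  congr 1
  ring

theorem weightConst_eq {R ρ C : ℝ} (hR : 0 < R) (hC : 0 ≤ C) :
    weightConst n (R ^ ρ) (C * R ^ (-(1 - ρ) * (n : ℝ))) =
      130 ^ (n + n) * ENNReal.ofReal ((C * 2⁻¹ ^ n) ^ 2 * ((R ^ n)⁻¹) ^ 2) := by
  unfold weightConst
  have hp : 0 ≤ R ^ (-(1 - ρ) * (n : ℝ)) := Real.rpow_nonneg hR.le _
  have hq : 0 ≤ R ^ ρ := Real.rpow_nonneg hR.le _
  rw [← ENNReal.ofReal_pow (by positivity), ← ENNReal.ofReal_pow (by positivity),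
    ← ENNReal.ofReal_mul (by positivity), ← scale_identity hR]
  congr 2
  rw [mul_inv]
  ring

/-- The ball volume contributes R^n and `scale_identity` contributes R^(-2n). The order n + (n + n)
counts n unfreezing steps and n weights for each input. -/
theorem exists_dyadicOp_cube_bound {ρ : ℝ} (hρ0 : 0 ≤ ρ) (hρ1 : ρ ≤ 1)
    {σ : Rn n × Rn n × Rn n → ℂ} (hσ : IsBilinearSymbol (-(1 - ρ) * (n : ℝ)) ρ ρ σ) :
    ∃ K : ℝ≥0, ∀ (j : ℕ) (c : Rn n) (f g : SchwartzMap (Rn n) ℂ),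
      ∫⁻ x in cube c (((2 : ℝ) ^ j) ^ ρ)⁻¹, ‖dyadicOp σ j f g x‖ₑ ^ 2 ≤
        K * ENNReal.ofReal (((2 : ℝ) ^ j) ^ n)⁻¹ *
          (eLpNorm f ∞ volume ^ 2 * eLpNorm g ∞ volume ^ 2) := by
  obtain ⟨C, hC0, hC⟩ := hσ.exists_amplitude hρ0 hρ1 (n + (n + n))
  have hfin : 4 ^ n * (volume (Metric.ball (0 : Rn n) 1) * 130 ^ (n + n)) *
      ENNReal.ofReal (2 ^ n * (C * 2⁻¹ ^ n) ^ 2) ≠ ∞ :=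
    ENNReal.mul_ne_top (ENNReal.mul_ne_top (by simp) (ENNReal.mul_ne_top
      measure_ball_lt_top.ne (by simp))) ENNReal.ofReal_ne_top
  refine ⟨(4 ^ n * (volume (Metric.ball (0 : Rn n) 1) * 130 ^ (n + n)) *
      ENNReal.ofReal (2 ^ n * (C * 2⁻¹ ^ n) ^ 2)).toNNReal, fun j c f g => ?_⟩
  rw [ENNReal.coe_toNNReal hfin]
  have hR : (0 : ℝ) < 2 ^ j := by positivity
  refine ((hC j).cube_bound (by positivity) c f g).trans (le_of_eq ?_)
  rw [weightConst_eq hR hC0, volume_closedBall_eq (by positivity), pow_succ (2 : ℝ) j]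
  generalize (2 : ℝ) ^ j = R at *
  have e : ENNReal.ofReal ((R * 2) ^ n) *
      ENNReal.ofReal ((C * 2⁻¹ ^ n) ^ 2 * ((R ^ n)⁻¹) ^ 2) =
      ENNReal.ofReal (2 ^ n * (C * 2⁻¹ ^ n) ^ 2) * ENNReal.ofReal (R ^ n)⁻¹ := by
    rw [← ENNReal.ofReal_mul (by positivity), ← ENNReal.ofReal_mul (by positivity)]
    congr 1
    rw [mul_pow]
    field_simp
  have e2 := congrArg ((4 ^ n * volume (Metric.ball (0 : Rn n) 1) * 130 ^ (n + n) *
    (eLpNorm f ∞ volume ^ 2 * eLpNorm g ∞ volume ^ 2)) * ·) e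
  ring_nf at e2 ⊢
  exact e2

theorem eLpNorm_top_ne_top (f : SchwartzMap (Rn n) ℂ) : eLpNorm f ∞ volume ≠ ∞ :=
  (f.memLp ∞ volume).2.ne

theorem enorm_sq_le_iff {z : ℂ} {X : ℝ≥0∞} (hX : X ≠ ∞) :
    ‖z‖ₑ ^ 2 ≤ X ↔ ‖z‖ ≤ Real.sqrt X.toReal := by
  rw [Real.le_sqrt (norm_nonneg _) ENNReal.toReal_nonneg, ← ofReal_norm,
    ← ENNReal.ofReal_pow (norm_nonneg _), ENNReal.ofReal_le_iff_le_toReal hX]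

/-- In the sup bound the two ball volumes R^(2n) exactly cancel R^(-2n). The mean value inequality
along the segment from y to x then leaves only the factor B‖x - y‖ of `Amplitude.pathDeriv`, whose
derivative is the extra one in n + n + 1. -/
theorem exists_dyadicOp_sub_bound {ρ : ℝ} (hρ0 : 0 ≤ ρ) (hρ1 : ρ ≤ 1)
    {σ : Rn n × Rn n × Rn n → ℂ} (hσ : IsBilinearSymbol (-(1 - ρ) * (n : ℝ)) ρ ρ σ) :
    ∃ K : ℝ≥0, ∀ (j : ℕ) (x y : Rn n) (f g : SchwartzMap (Rn n) ℂ),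
      ‖dyadicOp σ j f g x - dyadicOp σ j f g y‖ₑ ^ 2 ≤
        K * ENNReal.ofReal ((2 : ℝ) ^ j * ‖x - y‖) ^ 2 *
          (eLpNorm f ∞ volume ^ 2 * eLpNorm g ∞ volume ^ 2) := by
  obtain ⟨C, hC0, hC⟩ := hσ.exists_amplitude hρ0 hρ1 (n + n + 1)
  set c₀ : ℝ := 2 * Real.pi * 2 ^ (n + n) * 2 + n with hc₀
  have hc₀0 : 0 ≤ c₀ := by positivity
  have hfin : volume (Metric.ball (0 : Rn n) 1) ^ 2 * 130 ^ (n + n) *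
      ENNReal.ofReal ((c₀ * 2 * C) ^ 2) ≠ ∞ :=
    ENNReal.mul_ne_top (ENNReal.mul_ne_top (ENNReal.pow_ne_top measure_ball_lt_top.ne)
      (by simp)) (by simp)
  refine ⟨(volume (Metric.ball (0 : Rn n) 1) ^ 2 * 130 ^ (n + n) *
      ENNReal.ofReal ((c₀ * 2 * C) ^ 2)).toNNReal, fun j x y f g => ?_⟩
  rw [ENNReal.coe_toNNReal hfin]
  have hR : (0 : ℝ) < 2 ^ j := by positivity
  have hR1 : (1 : ℝ) ≤ 2 ^ j := one_le_pow₀ (by norm_num)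
  have hs : (0 : ℝ) < ((2 : ℝ) ^ j) ^ ρ := by positivity
  have hsB : ((2 : ℝ) ^ j) ^ ρ ≤ 2 ^ (j + 1) := by
    calc ((2 : ℝ) ^ j) ^ ρ ≤ ((2 : ℝ) ^ j) ^ (1 : ℝ) := Real.rpow_le_rpow_of_exponent_le hR1 hρ1
      _ = 2 ^ j := Real.rpow_one _
      _ ≤ 2 ^ (j + 1) := by rw [pow_succ]; linarith
  have ha := hC j
  set h := x - y with hh
  have hp := ha.pathDeriv hs hsB h
  have hder := hasDerivAt_multiplierOp (h := h) (k := h) ha.smooth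
    (fun q => (ha.bound q).norm_le) (fun q => (hp.bound q).norm_le) y y f g
  have hXfin : volume (Metric.ball (0 : Rn n) 1) ^ 2 * 130 ^ (n + n) *
      ENNReal.ofReal ((c₀ * 2 * C) ^ 2) * ENNReal.ofReal ((2 : ℝ) ^ j * ‖h‖) ^ 2 *
          (eLpNorm f ∞ volume ^ 2 * eLpNorm g ∞ volume ^ 2) ≠ ∞ :=
    ENNReal.mul_ne_top (ENNReal.mul_ne_top hfin (ENNReal.pow_ne_top ENNReal.ofReal_ne_top)) (ENNReal.mul_ne_top
      (ENNReal.pow_ne_top (eLpNorm_top_ne_top f)) (ENNReal.pow_ne_top (eLpNorm_top_ne_top g)))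
  rw [enorm_sq_le_iff hXfin]
  have key := norm_image_sub_le_of_norm_deriv_le_segment_01'
    (f := fun t : ℝ => multiplierOp (dyadicPiece σ j) (y + t • h) f g (y + t • h))
    (fun t _ => (hder t).hasDerivWithinAt) (C := Real.sqrt (ENNReal.toReal _)) fun t _ =>
      (enorm_sq_le_iff hXfin).1 ?_
  · simpa [hh, dyadicOp] using key
  refine (hp.sup_bound hs _ _ f g).trans (le_of_eq ?_)
  have e1 : (c₀ * (2 ^ (j + 1) * ‖h‖) * (C * ((2 : ℝ) ^ j) ^ (-(1 - ρ) * (n : ℝ)))) =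
      (c₀ * (2 ^ (j + 1) * ‖h‖) * C) * ((2 : ℝ) ^ j) ^ (-(1 - ρ) * (n : ℝ)) := by ring
  rw [e1, weightConst_eq hR (by positivity), volume_closedBall_eq (by positivity),
    pow_succ (2 : ℝ) j, mul_pow (ENNReal.ofReal _)]
  generalize (2 : ℝ) ^ j = R at *
  have e : ENNReal.ofReal ((R * 2) ^ n) ^ 2 *
      ENNReal.ofReal ((c₀ * (R * 2 * ‖h‖) * C * 2⁻¹ ^ n) ^ 2 * ((R ^ n)⁻¹) ^ 2) =
      ENNReal.ofReal ((c₀ * 2 * C) ^ 2) * ENNReal.ofReal (R * ‖h‖) ^ 2 := by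
    rw [← ENNReal.ofReal_pow (by positivity), ← ENNReal.ofReal_pow (by positivity),
      ← ENNReal.ofReal_mul (by positivity), ← ENNReal.ofReal_mul (by positivity)]
    congr 1
    have h2 : (2 : ℝ) ^ n * 2⁻¹ ^ n = 1 := by rw [← mul_pow]; norm_num
    have h3 : R ^ n * (R ^ n)⁻¹ = 1 := mul_inv_cancel₀ (by positivity)
    calc ((R * 2) ^ n) ^ 2 * ((c₀ * (R * 2 * ‖h‖) * C * 2⁻¹ ^ n) ^ 2 * ((R ^ n)⁻¹) ^ 2)
        = (2 ^ n * 2⁻¹ ^ n) ^ 2 * (R ^ n * (R ^ n)⁻¹) ^ 2 * ((c₀ * 2 * C) ^ 2 * (R * ‖h‖) ^ 2) := by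
          rw [mul_pow]; ring
      _ = (c₀ * 2 * C) ^ 2 * (R * ‖h‖) ^ 2 := by rw [h2, h3]; ring
  have e2 := congrArg ((volume (Metric.ball (0 : Rn n) 1) ^ 2 * 130 ^ (n + n) *
    (eLpNorm f ∞ volume ^ 2 * eLpNorm g ∞ volume ^ 2)) * ·) e
  ring_nf at e2 ⊢
  exact e2

end DyadicEstimates

/-! ### Geometry of cubes and mean oscillation. -/

section Cubes

variable {n : ℕ}

theorem cube_eq_image (a : Rn n) (l : ℝ) :
    cube a l = WithLp.toLp 2 '' Set.Icc (fun i => a i) (fun i => a i + l) := by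
  ext x
  refine ⟨fun h => ⟨fun i => x i, ⟨fun i => (h i).1, fun i => (h i).2⟩, rfl⟩, ?_⟩
  rintro ⟨y, hy, rfl⟩ i
  exact ⟨hy.1 i, hy.2 i⟩

theorem isCompact_cube (a : Rn n) (l : ℝ) : IsCompact (cube a l) := by
  rw [cube_eq_image]
  exact isCompact_Icc.image (PiLp.continuous_toLp 2 _)

theorem volume_cube (a : Rn n) (l : ℝ) : volume (cube a l) = ENNReal.ofReal l ^ n := by
  have h : cube a l = (MeasurableEquiv.toLp 2 (Fin n → ℝ)).symm ⁻¹'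
      Set.Icc (fun i => a i) (fun i => a i + l) := by
    ext x
    exact ⟨fun h => ⟨fun i => (h i).1, fun i => (h i).2⟩, fun h i => ⟨h.1 i, h.2 i⟩⟩
  rw [h, (EuclideanSpace.volume_preserving_symm_measurableEquiv_toLp (Fin n)).measure_preimage
    measurableSet_Icc.nullMeasurableSet, Real.volume_Icc_pi]
  simp

theorem volume_cube_ne_zero (a : Rn n) {l : ℝ} (hl : 0 < l) : volume (cube a l) ≠ 0 := by
  rw [volume_cube]
  exact pow_ne_zero _ (ENNReal.ofReal_pos.2 hl).ne'

theorem volume_cube_ne_top (a : Rn n) (l : ℝ) : volume (cube a l) ≠ ∞ :=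
  (isCompact_cube a l).measure_lt_top.ne

theorem norm_sub_le_of_mem_cube {a x : Rn n} {l : ℝ} (hx : x ∈ cube a l) : ‖x - a‖ ≤ n * l := by
  have e : x - a = ∑ i, (x i - a i) • (stdVec i : Rn n) := by
    ext j
    simp [stdVec, Finset.sum_apply, Pi.single_apply]
  rw [e]
  refine (norm_sum_le _ _).trans ?_
  calc ∑ i, ‖(x i - a i) • (stdVec i : Rn n)‖ ≤ ∑ _i : Fin n, l := by
        refine Finset.sum_le_sum fun i _ => ?_
        rw [norm_smul, norm_stdVec, mul_one, Real.norm_eq_abs,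
          abs_of_nonneg (sub_nonneg.2 (hx i).1)]
        linarith [(hx i).2]
    _ = n * l := by simp

/-- A point is placed in the grid cell indexed by ⌊(x_i - a_i)s⌋. The range of indices includes ⌊ls⌋
itself, so it is never empty, even when the small cubes are larger than the given one. -/
theorem cube_subset_iUnion {s l : ℝ} (hs : 0 < s) (a : Rn n) :
    cube a l ⊆ ⋃ k : Fin n → Fin (⌊l * s⌋₊ + 1),
      cube (WithLp.toLp 2 fun i => a i + s⁻¹ * (k i : ℕ)) s⁻¹ := by
  intro x hx
  have h0 : ∀ i, 0 ≤ (x i - a i) * s := fun i => mul_nonneg (sub_nonneg.2 (hx i).1) hs.le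
  have h1 : ∀ i, ⌊(x i - a i) * s⌋₊ < ⌊l * s⌋₊ + 1 := fun i =>
    Nat.lt_succ_of_le (Nat.floor_mono (mul_le_mul_of_nonneg_right (by linarith [(hx i).2]) hs.le))
  refine Set.mem_iUnion.2 ⟨fun i => ⟨_, h1 i⟩, fun i => ?_⟩
  have h2 := Nat.floor_le (h0 i)
  have h3 := (Nat.lt_floor_add_one ((x i - a i) * s)).le
  have h4 : (x i - a i) = s⁻¹ * ((x i - a i) * s) := by field_simp
  have h5 := mul_le_mul_of_nonneg_left h2 (inv_pos.2 hs).le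
  have h6 := mul_le_mul_of_nonneg_left h3 (inv_pos.2 hs).le
  rw [mul_add] at h6
  constructor <;> simp only <;> linarith

theorem lintegral_cube_le {s l : ℝ} (hs : 0 < s) (hl : 0 ≤ l) {F : Rn n → ℝ≥0∞} {X : ℝ≥0∞}
    (hF : ∀ c, ∫⁻ x in cube c s⁻¹, F x ≤ X) (a : Rn n) :
    ∫⁻ x in cube a l, F x ≤ ENNReal.ofReal (l * s + 1) ^ n * X := by
  calc ∫⁻ x in cube a l, F x ≤ ∫⁻ x in ⋃ k : Fin n → Fin (⌊l * s⌋₊ + 1),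
        cube (WithLp.toLp 2 fun i => a i + s⁻¹ * (k i : ℕ)) s⁻¹, F x :=
        lintegral_mono_set (cube_subset_iUnion hs a)
    _ ≤ ∑' k : Fin n → Fin (⌊l * s⌋₊ + 1),
        ∫⁻ x in cube (WithLp.toLp 2 fun i => a i + s⁻¹ * (k i : ℕ)) s⁻¹, F x :=
        lintegral_iUnion_le _ _
    _ ≤ ∑' _k : Fin n → Fin (⌊l * s⌋₊ + 1), X := ENNReal.tsum_le_tsum fun k => hF _
    _ = ((⌊l * s⌋₊ + 1 : ℕ) : ℝ≥0∞) ^ n * X := by simp [tsum_fintype]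
    _ ≤ ENNReal.ofReal (l * s + 1) ^ n * X := by
        gcongr
        rw [← ENNReal.ofReal_natCast]
        apply ENNReal.ofReal_le_ofReal
        push_cast
        linarith [Nat.floor_le (mul_nonneg hl hs.le)]

/-- The mean oscillation over a cube is controlled by the mean distance to any constant. -/
theorem oscillation_le {F : Rn n → ℂ} {a : Rn n} {l : ℝ} (hl : 0 < l)
    (hF : IntegrableOn F (cube a l)) (c : ℂ) :
    (volume (cube a l))⁻¹ * ∫⁻ x in cube a l, ‖F x - ⨍ y in cube a l, F y‖ₑ ≤
      2 * ((volume (cube a l))⁻¹ * ∫⁻ x in cube a l, ‖F x - c‖ₑ) := by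
  have h0 := volume_cube_ne_zero a hl
  have h1 := volume_cube_ne_top a l
  have hfin : IsFiniteMeasure (volume.restrict (cube a l)) := ⟨by simpa using h1.lt_top⟩
  set Q := cube a l
  set J := (volume Q)⁻¹ * ∫⁻ x in Q, ‖F x - c‖ₑ with hJ
  have hav : ‖c - ⨍ y in Q, F y‖ₑ ≤ J := by
    have e : (⨍ y in Q, F y) - c = (volume.real Q)⁻¹ • ∫ y in Q, (F y - c) := by
      rw [integral_sub hF (integrable_const c), smul_sub, ← setAverage_eq, ← setAverage_eq,
        setAverage_const h0 h1]
    rw [enorm_sub_rev, e, enorm_smul, hJ]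
    gcongr
    · rw [Real.enorm_of_nonneg (by positivity), measureReal_def,
        ENNReal.ofReal_inv_of_pos (ENNReal.toReal_pos h0 h1), ENNReal.ofReal_toReal h1]
    · exact enorm_integral_le_lintegral_enorm _
  calc (volume Q)⁻¹ * ∫⁻ x in Q, ‖F x - ⨍ y in Q, F y‖ₑ
      ≤ (volume Q)⁻¹ * ∫⁻ x in Q, (‖F x - c‖ₑ + J) := by
        gcongr with x
        calc ‖F x - ⨍ y in Q, F y‖ₑ = ‖(F x - c) + (c - ⨍ y in Q, F y)‖ₑ := by
              rw [sub_add_sub_cancel]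
          _ ≤ ‖F x - c‖ₑ + ‖c - ⨍ y in Q, F y‖ₑ := enorm_add_le _ _
          _ ≤ _ := by gcongr
    _ = J + (volume Q)⁻¹ * (J * volume Q) := by
        rw [lintegral_add_right _ measurable_const, mul_add, lintegral_const,
          Measure.restrict_apply_univ]
    _ = 2 * J := by
        rw [mul_comm J, ← mul_assoc, ENNReal.inv_mul_cancel h0 h1, one_mul, two_mul]

end Cubes

/-! ### Mean estimates for dyadic pieces and their summability over scales. -/

section MeanEstimates

variable {n : ℕ}

theorem lintegral_cube_sq_le {a : Rn n} {l : ℝ} (hl : 0 < l) {F : Rn n → ℝ≥0∞}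
    (hF : Measurable F) : ((volume (cube a l))⁻¹ * ∫⁻ x in cube a l, F x) ^ 2 ≤
      (volume (cube a l))⁻¹ * ∫⁻ x in cube a l, F x ^ 2 := by
  have h0 := volume_cube_ne_zero a hl
  have h1 := volume_cube_ne_top a l
  have h := lintegral_mul_sq_le (μ := volume.restrict (cube a l)) (f := fun _ => 1) (g := F)
    aemeasurable_const hF.aemeasurable
  simp only [one_mul, one_pow, lintegral_const, Measure.restrict_apply_univ] at h
  calc _ = (volume (cube a l))⁻¹ ^ 2 * (∫⁻ x in cube a l, F x) ^ 2 := mul_pow _ _ _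
    _ ≤ (volume (cube a l))⁻¹ ^ 2 * (volume (cube a l) * ∫⁻ x in cube a l, F x ^ 2) := by gcongr
    _ = (volume (cube a l))⁻¹ * ∫⁻ x in cube a l, F x ^ 2 := by
      rw [sq, mul_assoc, ← mul_assoc _ (volume _), ENNReal.inv_mul_cancel h0 h1, one_mul]

/-- The decay of the scale `t` piece: a power below the critical scale, a negative power above. -/
def scaleDecay (t : ℝ) : ℝ := if 1 ≤ t then (√t)⁻¹ else t

theorem scaleDecay_nonneg {t : ℝ} (ht : 0 ≤ t) : 0 ≤ scaleDecay t := by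
  unfold scaleDecay
  split_ifs <;> positivity

/-- A potential whose increments along doublings dominate `scaleDecay`. -/
def decayPotential (t : ℝ) : ℝ := if 1 ≤ t then 6 - 4 * (√t)⁻¹ else t

theorem decayPotential_mem {t : ℝ} (ht : 0 ≤ t) :
    0 ≤ decayPotential t ∧ decayPotential t ≤ 6 := by
  unfold decayPotential
  split_ifs with h
  · have h1 : 1 ≤ √t := Real.one_le_sqrt.2 h
    have h2 : (√t)⁻¹ ≤ 1 := inv_le_one_of_one_le₀ h1
    have h3 : 0 ≤ (√t)⁻¹ := by positivity
    constructor <;> linarith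
  · constructor <;> linarith

theorem inv_sqrt_two_mul_le (t : ℝ) : (√(2 * t))⁻¹ ≤ 3 / 4 * (√t)⁻¹ := by
  rw [Real.sqrt_mul zero_le_two, mul_inv]
  refine mul_le_mul_of_nonneg_right ?_ (by positivity)
  rw [inv_le_comm₀ (by positivity) (by norm_num)]
  exact Real.le_sqrt_of_sq_le (by norm_num)

/-- For t ≥ 1 the increment is 4(t^(-1/2) - (2t)^(-1/2)) ≥ t^(-1/2), since 1/√2 ≤ 3/4. If 2t < 1,
doubling adds exactly t. In the crossing case the potential reaches at least 6 - 4 = 2, so it rises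
by at least 2 - t > t. Sums over dyadic scales then telescope, uniformly in the starting scale. -/
theorem scaleDecay_le (t : ℝ) :
    scaleDecay t ≤ decayPotential (2 * t) - decayPotential t := by
  unfold scaleDecay decayPotential
  have h3 : 0 ≤ (√t)⁻¹ := by positivity
  by_cases h : 1 ≤ t
  · rw [if_pos h, if_pos (by linarith), if_pos h]
    linarith [inv_sqrt_two_mul_le t]
  · rw [if_neg h, if_neg h]
    split_ifs with h2
    · have h1 : 1 ≤ √(2 * t) := Real.one_le_sqrt.2 h2
      have h4 : (√(2 * t))⁻¹ ≤ 1 := inv_le_one_of_one_le₀ h1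
      linarith
    · linarith

theorem sum_scaleDecay_le {l : ℝ} (hl : 0 ≤ l) (J : ℕ) :
    ∑ j ∈ Finset.range J, scaleDecay (l * 2 ^ j) ≤ 6 := by
  calc ∑ j ∈ Finset.range J, scaleDecay (l * 2 ^ j)
      ≤ ∑ j ∈ Finset.range J, (decayPotential (l * 2 ^ (j + 1)) - decayPotential (l * 2 ^ j)) := by
        refine Finset.sum_le_sum fun j _ => ?_
        have := scaleDecay_le (l * 2 ^ j)
        rwa [show 2 * (l * 2 ^ j) = l * 2 ^ (j + 1) by ring] at this
    _ = decayPotential (l * 2 ^ J) - decayPotential (l * 2 ^ 0) :=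
        Finset.sum_range_sub (fun j => decayPotential (l * 2 ^ j)) J
    _ ≤ 6 := by
        have h1 := decayPotential_mem (t := l * 2 ^ J) (by positivity)
        have h2 := decayPotential_mem (t := l * 2 ^ 0) (by positivity)
        linarith

theorem tsum_ofReal_decay_le {q l : ℝ} (hq0 : 0 ≤ q) (hq1 : q < 1) (hl : 0 ≤ l) :
    ∑' j : ℕ, ENNReal.ofReal (q ^ j + scaleDecay (l * 2 ^ j)) ≤
      ENNReal.ofReal ((1 - q)⁻¹ + 6) := by
  have hd : ∀ j : ℕ, 0 ≤ scaleDecay (l * 2 ^ j) := fun j => scaleDecay_nonneg (by positivity)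
  refine ENNReal.tsum_le_of_sum_range_le fun J => ?_
  rw [← ENNReal.ofReal_sum_of_nonneg fun j _ => add_nonneg (pow_nonneg hq0 j) (hd j),
    Finset.sum_add_distrib]
  exact ENNReal.ofReal_le_ofReal (add_le_add
    ((summable_geometric_of_lt_one hq0 hq1).sum_le_tsum _ (fun j _ => pow_nonneg hq0 j) |>.trans
      (tsum_geometric_of_lt_one hq0 hq1).le) (sum_scaleDecay_le hl J))

theorem two_rpow_half_sq (ρ : ℝ) (j : ℕ) :
    (((2 : ℝ) ^ (-(1 - ρ) / 2)) ^ j) ^ 2 = ((2 : ℝ) ^ j) ^ ρ / 2 ^ j := by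
  rw [← Real.rpow_natCast, ← Real.rpow_natCast, ← Real.rpow_mul zero_le_two,
    ← Real.rpow_mul zero_le_two, ← Real.rpow_natCast 2 j, ← Real.rpow_mul zero_le_two,
    ← Real.rpow_sub zero_lt_two]
  congr 1
  push_cast
  ring

/-- The left side is (s/R + 1/(lR))^n with base u² + w² ≤ 2. One factor is kept for decay, which
requires n ≥ 1, and the others are bounded by 2. -/
theorem ratio_pow_le (hn : n ≠ 0) {R s l u w : ℝ} (hR : 0 < R) (hs : 0 ≤ s) (hsR : s ≤ R)
    (hl : 0 < l) (hlR : 1 ≤ l * R) (hu : 0 ≤ u) (hw : 0 ≤ w) (hus : u ^ 2 = s / R)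
    (hwl : w ^ 2 = (l * R)⁻¹) :
    (l ^ n)⁻¹ * (l * s + 1) ^ n * (R ^ n)⁻¹ ≤ 2 ^ n * (u + w) ^ 2 := by
  have e : (l ^ n)⁻¹ * (l * s + 1) ^ n * (R ^ n)⁻¹ = (s / R + (l * R)⁻¹) ^ n := by
    rw [← inv_pow, ← inv_pow, ← mul_pow, ← mul_pow]
    congr 1
    field_simp
  have h1 : s / R ≤ 1 := (div_le_one hR).2 hsR
  have h2 : (l * R)⁻¹ ≤ 1 := inv_le_one_of_one_le₀ hlR
  have h3 : 0 ≤ s / R := by positivity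
  have h4 : 0 ≤ (l * R)⁻¹ := by positivity
  obtain ⟨k, rfl⟩ := Nat.exists_eq_succ_of_ne_zero hn
  rw [e, Nat.succ_eq_add_one, pow_succ]
  calc (s / R + (l * R)⁻¹) ^ k * (s / R + (l * R)⁻¹) ≤ 2 ^ k * (u + w) ^ 2 := by
        gcongr
        · linarith
        · rw [← hus, ← hwl]; nlinarith
    _ ≤ 2 ^ (k + 1) * (u + w) ^ 2 := by
        gcongr
        · norm_num
        · omega

/-- The constant K + 1 avoids a square root, as K ≤ (K + 1)². -/
theorem enorm_le_of_sq_le {K : ℝ≥0} {r X Y t : ℝ≥0∞}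
    (h : t ^ 2 ≤ K * r ^ 2 * (X ^ 2 * Y ^ 2)) : t ≤ ((K + 1 : ℝ≥0) : ℝ≥0∞) * r * (X * Y) := by
  refine (ENNReal.pow_le_pow_left_iff two_ne_zero).1 (h.trans ?_)
  rw [mul_pow, mul_pow, mul_pow]
  gcongr
  rw [← ENNReal.coe_pow, ENNReal.coe_le_coe]
  nlinarith [K.2]

theorem continuous_dyadicOp {m ρ : ℝ} (hρ0 : 0 ≤ ρ) (hρ1 : ρ ≤ 1)
    {σ : Rn n × Rn n × Rn n → ℂ} (hσ : IsBilinearSymbol m ρ ρ σ) (j : ℕ)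
    (f g : SchwartzMap (Rn n) ℂ) : Continuous fun x => dyadicOp σ j f g x := by
  obtain ⟨C, -, hC⟩ := hσ.exists_amplitude hρ0 hρ1 0
  have h := (hC j).continuous_multiplierOp f g
  have h2 : Continuous fun x : Rn n => (x, x) := by fun_prop
  have h3 := h.comp h2
  exact h3

/-- The constant that approximates the `j`-th dyadic piece on the cube with corner `a` and
side `l`. -/
def pieceConst (σ : Rn n × Rn n × Rn n → ℂ) (f g : SchwartzMap (Rn n) ℂ) (a : Rn n) (l : ℝ)
    (j : ℕ) : ℂ :=
  if 1 ≤ l * 2 ^ j then 0 else dyadicOp σ j f g a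

/-- Above the critical scale no constant is subtracted: pass from the mean to the mean square, cover
by cubes of side 2^(-jρ), and take square roots with u = 2^(-j(1-ρ)/2) and w = (l 2^j)^(-1/2). -/
theorem exists_mean_dyadicOp_bound_of_one_le (hn : n ≠ 0) {ρ : ℝ} (hρ0 : 0 ≤ ρ) (hρ1 : ρ ≤ 1)
    {σ : Rn n × Rn n × Rn n → ℂ} (hσ : IsBilinearSymbol (-(1 - ρ) * (n : ℝ)) ρ ρ σ) :
    ∃ K : ℝ≥0, ∀ (j : ℕ) (a : Rn n) (l : ℝ), 0 < l → 1 ≤ l * 2 ^ j →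
      ∀ f g : SchwartzMap (Rn n) ℂ,
      (volume (cube a l))⁻¹ * ∫⁻ x in cube a l, ‖dyadicOp σ j f g x‖ₑ ≤
        K * ENNReal.ofReal (((2 : ℝ) ^ (-(1 - ρ) / 2)) ^ j + scaleDecay (l * 2 ^ j)) *
          (eLpNorm f ∞ volume * eLpNorm g ∞ volume) := by
  obtain ⟨K₁, hK₁⟩ := exists_dyadicOp_cube_bound hρ0 hρ1 hσ
  refine ⟨K₁ * 2 ^ n + 1, fun j a l hl hj f g => enorm_le_of_sq_le ?_⟩
  have hq : (0 : ℝ) ≤ ((2 : ℝ) ^ (-(1 - ρ) / 2)) ^ j := by positivity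
  have hR : (0 : ℝ) < 2 ^ j := by positivity
  have hR1 : (1 : ℝ) ≤ 2 ^ j := one_le_pow₀ (by norm_num)
  have hs : (0 : ℝ) < ((2 : ℝ) ^ j) ^ ρ := by positivity
  have hsR : ((2 : ℝ) ^ j) ^ ρ ≤ 2 ^ j := by
    simpa using Real.rpow_le_rpow_of_exponent_le hR1 hρ1
  have hd : 0 ≤ scaleDecay (l * 2 ^ j) := scaleDecay_nonneg (by positivity)
  refine (lintegral_cube_sq_le hl
    (continuous_dyadicOp hρ0 hρ1 hσ j f g).enorm.measurable).trans ?_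
  refine (mul_le_mul_right (lintegral_cube_le hs hl.le (fun c => hK₁ j c f g) a) _).trans ?_
  have hr := ratio_pow_le hn hR hs.le hsR hl hj hq hd (two_rpow_half_sq ρ j) (by
    rw [scaleDecay, if_pos hj, inv_pow, Real.sq_sqrt (by positivity)])
  generalize scaleDecay (l * 2 ^ j) = w at *
  generalize ((2 : ℝ) ^ (-(1 - ρ) / 2)) ^ j = u at *
  generalize (2 : ℝ) ^ j = R at *
  generalize R ^ ρ = s at *
  have hr2 := ENNReal.ofReal_le_ofReal hr
  rw [ENNReal.ofReal_mul (by positivity), ENNReal.ofReal_mul (by positivity),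
    ENNReal.ofReal_mul (by positivity), ENNReal.ofReal_inv_of_pos (by positivity),
    ENNReal.ofReal_pow hl.le, ENNReal.ofReal_pow (by positivity),
    ENNReal.ofReal_pow zero_le_two, ENNReal.ofReal_pow (add_nonneg hq hd),
    ENNReal.ofReal_ofNat] at hr2
  rw [volume_cube]
  generalize eLpNorm f ∞ volume ^ 2 * eLpNorm g ∞ volume ^ 2 = M
  push_cast
  calc _ = ((ENNReal.ofReal l ^ n)⁻¹ * ENNReal.ofReal (l * s + 1) ^ n *
        ENNReal.ofReal (R ^ n)⁻¹) * (K₁ * M) := by ring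
    _ ≤ (2 ^ n * ENNReal.ofReal (u + w) ^ 2) * (K₁ * M) := by gcongr
    _ = _ := by ring

theorem exists_mean_dyadicOp_bound_of_lt_one {ρ : ℝ} (hρ0 : 0 ≤ ρ) (hρ1 : ρ ≤ 1)
    {σ : Rn n × Rn n × Rn n → ℂ} (hσ : IsBilinearSymbol (-(1 - ρ) * (n : ℝ)) ρ ρ σ) :
    ∃ K : ℝ≥0, ∀ (j : ℕ) (a : Rn n) (l : ℝ), 0 < l → ∀ f g : SchwartzMap (Rn n) ℂ,
      (volume (cube a l))⁻¹ * ∫⁻ x in cube a l, ‖dyadicOp σ j f g x - dyadicOp σ j f g a‖ₑ ≤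
        K * ENNReal.ofReal (l * 2 ^ j) * (eLpNorm f ∞ volume * eLpNorm g ∞ volume) := by
  obtain ⟨K₂, hK₂⟩ := exists_dyadicOp_sub_bound hρ0 hρ1 hσ
  refine ⟨(K₂ + 1) * n, fun j a l hl f g => ?_⟩
  have hx : ∀ x ∈ cube a l, ‖dyadicOp σ j f g x - dyadicOp σ j f g a‖ₑ ≤
      ((K₂ + 1) * n : ℝ≥0) * ENNReal.ofReal (l * 2 ^ j) *
        (eLpNorm f ∞ volume * eLpNorm g ∞ volume) := fun x hx => by
    refine (enorm_le_of_sq_le (hK₂ j x a f g)).trans ?_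
    have : ENNReal.ofReal (2 ^ j * ‖x - a‖) ≤ n * ENNReal.ofReal (l * 2 ^ j) := by
      rw [← ENNReal.ofReal_natCast n, ← ENNReal.ofReal_mul (by positivity)]
      apply ENNReal.ofReal_le_ofReal
      calc (2 : ℝ) ^ j * ‖x - a‖ ≤ 2 ^ j * (n * l) := by
            gcongr
            exact norm_sub_le_of_mem_cube hx
        _ = n * (l * 2 ^ j) := by ring
    rw [ENNReal.coe_mul, ENNReal.coe_natCast, mul_assoc (_ : ℝ≥0∞) (n : ℝ≥0∞)]
    gcongr
  refine (mul_le_mul_right (setLIntegral_mono' (measurableSet_cube a l) hx) _).trans ?_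
  rw [lintegral_const, Measure.restrict_apply_univ, mul_comm _ (volume _), ← mul_assoc,
    ENNReal.inv_mul_cancel (volume_cube_ne_zero a hl) (volume_cube_ne_top a l), one_mul]

theorem exists_mean_dyadicOp_bound (hn : n ≠ 0) {ρ : ℝ} (hρ0 : 0 ≤ ρ) (hρ1 : ρ ≤ 1)
    {σ : Rn n × Rn n × Rn n → ℂ} (hσ : IsBilinearSymbol (-(1 - ρ) * (n : ℝ)) ρ ρ σ) :
    ∃ K : ℝ≥0, ∀ (j : ℕ) (a : Rn n) (l : ℝ), 0 < l → ∀ f g : SchwartzMap (Rn n) ℂ,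
      (volume (cube a l))⁻¹ *
          ∫⁻ x in cube a l, ‖dyadicOp σ j f g x - pieceConst σ f g a l j‖ₑ ≤
        K * ENNReal.ofReal (((2 : ℝ) ^ (-(1 - ρ) / 2)) ^ j + scaleDecay (l * 2 ^ j)) *
          (eLpNorm f ∞ volume * eLpNorm g ∞ volume) := by
  obtain ⟨K₁, hK₁⟩ := exists_mean_dyadicOp_bound_of_one_le hn hρ0 hρ1 hσ
  obtain ⟨K₂, hK₂⟩ := exists_mean_dyadicOp_bound_of_lt_one hρ0 hρ1 hσ
  refine ⟨K₁ + K₂, fun j a l hl f g => ?_⟩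
  have hq : (0 : ℝ) ≤ ((2 : ℝ) ^ (-(1 - ρ) / 2)) ^ j := by positivity
  by_cases hj : 1 ≤ l * 2 ^ j
  · simp only [pieceConst, if_pos hj, sub_zero]
    refine (hK₁ j a l hl hj f g).trans ?_
    gcongr
    exact_mod_cast le_self_add
  · simp only [pieceConst, if_neg hj]
    refine (hK₂ j a l hl f g).trans ?_
    rw [scaleDecay, if_neg hj]
    gcongr
    · exact_mod_cast le_add_self
    · linarith

end MeanEstimates

/-! ### Summation of the dyadic pieces and the BMO bound. -/

section DyadicSum

open Filter Topology
open scoped FourierTransform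

variable {n : ℕ}

theorem IsBilinearSymbol.exists_norm_le {m ρ δ : ℝ} (hm : m ≤ 0) {σ : Rn n × Rn n × Rn n → ℂ}
    (hσ : IsBilinearSymbol m ρ δ σ) : ∃ C : ℝ, 0 ≤ C ∧ ∀ q, ‖σ q‖ ≤ C := by
  obtain ⟨C, hC0, hC⟩ := hσ.bound 0 0 0
  refine ⟨C, hC0.le, fun q => ?_⟩
  have h := hC q.1 q.2.1 q.2.2
  simp only [mixedDeriv, multiDeriv_zero] at h
  refine h.trans (mul_le_of_le_one_right hC0.le ?_)
  refine Real.rpow_le_one_of_one_le_of_nonpos ?_ (by simpa [multiLen] using hm)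
  linarith [norm_nonneg q.2.1, norm_nonneg q.2.2]

theorem continuous_bilinearOp {m ρ δ : ℝ} (hm : m ≤ 0) {σ : Rn n × Rn n × Rn n → ℂ}
    (hσ : IsBilinearSymbol m ρ δ σ) (f g : SchwartzMap (Rn n) ℂ) :
    Continuous (bilinearOp σ f g) := by
  obtain ⟨C, -, hC⟩ := hσ.exists_norm_le hm
  have h := continuous_multiplierOp (a := fun q => σ (freqScale q))
    (hσ.smooth.continuous.comp freqScale.continuous) (fun q => hC _) f g
  have h2 : Continuous fun x : Rn n => (x, x) := by fun_prop
  have h3 := h.comp h2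
  rw [show bilinearOp σ f g = _ from funext (bilinearOp_eq_multiplierOp σ f g)]
  exact h3

theorem sum_dyadicOp {m ρ : ℝ} (hρ0 : 0 ≤ ρ) (hρ1 : ρ ≤ 1) {σ : Rn n × Rn n × Rn n → ℂ}
    (hσ : IsBilinearSymbol m ρ ρ σ) (J : ℕ) (f g : SchwartzMap (Rn n) ℂ) (x : Rn n) :
    ∑ j ∈ Finset.range (J + 1), dyadicOp σ j f g x =
      multiplierOp (fun q => σ (freqScale q) * freqCutoff J q) x f g x := by
  obtain ⟨C, -, hC⟩ := hσ.exists_amplitude hρ0 hρ1 0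
  unfold dyadicOp multiplierOp
  rw [← integral_finsetSum _ fun j _ => integrable_multiplierOp
    (hC j).smooth.continuous x (fun p => ((hC j).bound (x, p)).norm_le) f g x]
  congr 1
  funext p
  have e : ∑ j ∈ Finset.range (J + 1), dyadicPiece σ j (x, p) =
      σ (freqScale (x, p)) * freqCutoff J (x, p) := by
    rw [← sum_dyadicCutoff, Finset.mul_sum]
    rfl
  rw [← Finset.sum_mul, ← Finset.mul_sum, e]

/-- The partial sums telescope to the operator with a truncated symbol. Since m ≤ 0 the symbol is
bounded, so dominated convergence applies, the cutoff being eventually 1 at each frequency. -/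
theorem tendsto_sum_dyadicOp {m ρ : ℝ} (hm : m ≤ 0) (hρ0 : 0 ≤ ρ) (hρ1 : ρ ≤ 1)
    {σ : Rn n × Rn n × Rn n → ℂ} (hσ : IsBilinearSymbol m ρ ρ σ)
    (f g : SchwartzMap (Rn n) ℂ) (x : Rn n) :
    Tendsto (fun J => ∑ j ∈ Finset.range (J + 1), dyadicOp σ j f g x) atTop
      (𝓝 (bilinearOp σ f g x)) := by
  obtain ⟨C, hC0, hC⟩ := hσ.exists_norm_le hm
  simp only [sum_dyadicOp hρ0 hρ1 hσ, bilinearOp_eq_multiplierOp]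
  unfold multiplierOp
  have hσc : Continuous fun q => σ (freqScale q) := hσ.smooth.continuous.comp freqScale.continuous
  refine tendsto_integral_of_dominated_convergence (fun p => C *
    ‖(𝓕 f : SchwartzMap (Rn n) ℂ) p.1 * (𝓕 g : SchwartzMap (Rn n) ℂ) p.2‖) (fun J => ?_)
    ((integrable_fourier_prod f g).norm.const_mul C) (fun J => Eventually.of_forall fun p => ?_)
    (Eventually.of_forall fun p => ?_)
  · refine (integrable_multiplierOp (a := fun q => σ (freqScale q) * freqCutoff J q) (A := C * 1)
      (hσc.mul (smooth_freqCutoff J).continuous) x (fun p => ?_) f g x).aestronglyMeasurable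
    rw [norm_mul]
    exact mul_le_mul (hC _) (norm_freqCutoff_le J _) (norm_nonneg _) hC0
  · rw [norm_mul, norm_mul, Circle.norm_coe, one_mul, norm_mul]
    refine mul_le_mul_of_nonneg_right ?_ (norm_nonneg _)
    exact (mul_le_of_le_one_right (norm_nonneg _) (norm_freqCutoff_le J _)).trans (hC _)
  · refine tendsto_const_nhds.congr' ?_
    obtain ⟨N, hN⟩ := pow_unbounded_of_one_lt ‖p‖ one_lt_two
    filter_upwards [eventually_ge_atTop N] with J hJ
    have hp : ‖p‖ ≤ 2 ^ J := hN.le.trans (pow_le_pow_right₀ one_le_two hJ)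
    have h1 : freqCutoff J (x, p) = 1 := freqCutoff_eq_one (q := (x, p)) hp
    rw [h1, mul_one]

theorem exists_enorm_bilinearOp_sub_le {m ρ : ℝ} (hm : m ≤ 0) (hρ0 : 0 ≤ ρ) (hρ1 : ρ ≤ 1)
    {σ : Rn n × Rn n × Rn n → ℂ} (hσ : IsBilinearSymbol m ρ ρ σ)
    (f g : SchwartzMap (Rn n) ℂ) (a : Rn n) {l : ℝ} (hl : 0 < l) :
    ∃ c : ℂ, ∀ x, ‖bilinearOp σ f g x - c‖ₑ ≤
      ∑' j, ‖dyadicOp σ j f g x - pieceConst σ f g a l j‖ₑ := by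
  obtain ⟨N, hN⟩ := pow_unbounded_of_one_lt l⁻¹ one_lt_two
  have hz : ∀ j, N ≤ j → pieceConst σ f g a l j = 0 := fun j hj => by
    refine if_pos ?_
    have h1 : l⁻¹ ≤ 2 ^ j := hN.le.trans (pow_le_pow_right₀ one_le_two hj)
    calc (1 : ℝ) = l * l⁻¹ := (mul_inv_cancel₀ hl.ne').symm
      _ ≤ l * 2 ^ j := by gcongr
  -- Only the scales with l 2^j < 1 contribute a nonzero constant, so this finite sum is a single
  -- constant for the whole cube.
  refine ⟨∑ j ∈ Finset.range N, pieceConst σ f g a l j, fun x => ?_⟩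
  refine le_of_tendsto (((tendsto_sum_dyadicOp hm hρ0 hρ1 hσ f g x).sub_const _).enorm) ?_
  filter_upwards [eventually_ge_atTop N] with J hJ
  have e : ∑ j ∈ Finset.range N, pieceConst σ f g a l j =
      ∑ j ∈ Finset.range (J + 1), pieceConst σ f g a l j :=
    Finset.sum_subset (Finset.range_subset_range.2 (by omega)) fun j _ hj =>
      hz j (by simpa using hj)
  rw [e, ← Finset.sum_sub_distrib]
  exact (enorm_sum_le _ _).trans (ENNReal.sum_le_tsum _)

theorem exists_bmoNorm_bilinearOp_le {ρ : ℝ} (hρ0 : 0 ≤ ρ) (hρ1 : ρ < 1)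
    {σ : Rn n × Rn n × Rn n → ℂ} (hσ : IsBilinearSymbol (-(1 - ρ) * (n : ℝ)) ρ ρ σ) :
    ∃ A : ℝ≥0, ∀ f g : SchwartzMap (Rn n) ℂ,
      bmoNorm (bilinearOp σ f g) ≤ A * eLpNorm f ∞ volume * eLpNorm g ∞ volume := by
  have hm : -(1 - ρ) * (n : ℝ) ≤ 0 :=
    mul_nonpos_of_nonpos_of_nonneg (by linarith) (Nat.cast_nonneg n)
  have hint : ∀ (f g : SchwartzMap (Rn n) ℂ) a l, IntegrableOn (bilinearOp σ f g) (cube a l) :=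
    fun f g a l => (continuous_bilinearOp hm hσ f g).continuousOn.integrableOn_compact
      (isCompact_cube a l)
  rcases eq_or_ne n 0 with rfl | hn
  -- In dimension 0 the decay of `ratio_pow_le` is lost, but the space is a point and every
  -- oscillation vanishes.
  · refine ⟨0, fun f g => iSup_le fun a => iSup_le fun l => iSup_le fun hl => ?_⟩
    refine (oscillation_le hl (hint f g a l) (bilinearOp σ f g 0)).trans ?_
    simp [Subsingleton.elim _ (0 : Rn 0)]
  obtain ⟨K, hK⟩ := exists_mean_dyadicOp_bound hn hρ0 hρ1.le hσ
  set q : ℝ := (2 : ℝ) ^ (-(1 - ρ) / 2) with hq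
  have hq0 : 0 ≤ q := by positivity
  -- The strict inequality ρ < 1 is needed here, for the geometric series in q.
  have hq1 : q < 1 := Real.rpow_lt_one_of_one_lt_of_neg one_lt_two (by linarith)
  refine ⟨2 * (K * Real.toNNReal ((1 - q)⁻¹ + 6)), fun f g =>
    iSup_le fun a => iSup_le fun l => iSup_le fun hl => ?_⟩
  obtain ⟨c, hc⟩ := exists_enorm_bilinearOp_sub_le hm hρ0 hρ1.le hσ f g a hl
  refine (oscillation_le hl (hint f g a l) c).trans ?_
  have hM : ∀ j, AEMeasurable (fun x => ‖dyadicOp σ j f g x - pieceConst σ f g a l j‖ₑ)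
      (volume.restrict (cube a l)) := fun j =>
    ((continuous_dyadicOp hρ0 hρ1.le hσ j f g).sub continuous_const).enorm.aemeasurable
  have key : (volume (cube a l))⁻¹ * ∫⁻ x in cube a l, ‖bilinearOp σ f g x - c‖ₑ ≤
      K * ENNReal.ofReal ((1 - q)⁻¹ + 6) * (eLpNorm f ∞ volume * eLpNorm g ∞ volume) := by
    calc (volume (cube a l))⁻¹ * ∫⁻ x in cube a l, ‖bilinearOp σ f g x - c‖ₑ
        ≤ (volume (cube a l))⁻¹ *
          ∫⁻ x in cube a l, ∑' j, ‖dyadicOp σ j f g x - pieceConst σ f g a l j‖ₑ := by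
          gcongr with x
          exact hc x
      _ = ∑' j, (volume (cube a l))⁻¹ *
          ∫⁻ x in cube a l, ‖dyadicOp σ j f g x - pieceConst σ f g a l j‖ₑ := by
          rw [lintegral_tsum hM, ENNReal.tsum_mul_left]
      _ ≤ ∑' j : ℕ, K * ENNReal.ofReal (q ^ j + scaleDecay (l * 2 ^ j)) *
          (eLpNorm f ∞ volume * eLpNorm g ∞ volume) :=
          ENNReal.tsum_le_tsum fun j => hK j a l hl f g
      _ ≤ _ := by
          rw [ENNReal.tsum_mul_right, ENNReal.tsum_mul_left]
          gcongr
          exact tsum_ofReal_decay_le hq0 hq1 hl.le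
  refine (mul_le_mul_right key 2).trans (le_of_eq ?_)
  push_cast
  rw [ENNReal.ofReal]
  ring

end DyadicSum

end BilinearPDO

end

theorem mainTheorem2 (n : ℕ) (ρ : ℝ) (hρ0 : 0 ≤ ρ) (hρ1 : ρ < 1)
    (σ : BilinearPDO.Rn n × BilinearPDO.Rn n × BilinearPDO.Rn n → ℂ)
    (hσ : BilinearPDO.IsBilinearSymbol (-(1 - ρ) * (n : ℝ)) ρ ρ σ) :
    ∃ A : ℝ≥0, ∀ f g : SchwartzMap (BilinearPDO.Rn n) ℂ,
      BilinearPDO.MemBMO (BilinearPDO.bilinearOp σ f g) ∧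
      BilinearPDO.bmoNorm (BilinearPDO.bilinearOp σ f g) ≤
        (A : ℝ≥0∞) * eLpNorm (fun x => f x) ∞ volume * eLpNorm (fun x => g x) ∞ volume := by
  have hm : -(1 - ρ) * (n : ℝ) ≤ 0 :=
    mul_nonpos_of_nonpos_of_nonneg (by linarith) (Nat.cast_nonneg n)
  obtain ⟨A, hA⟩ := BilinearPDO.exists_bmoNorm_bilinearOp_le hρ0 hρ1 hσ
  refine ⟨A, fun f g => ⟨⟨?_, (hA f g).trans_lt ?_⟩, hA f g⟩⟩
  · exact (BilinearPDO.continuous_bilinearOp hm hσ f g).locallyIntegrable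
  · exact ENNReal.mul_lt_top (ENNReal.mul_lt_top ENNReal.coe_lt_top
      (BilinearPDO.eLpNorm_top_ne_top f).lt_top) (BilinearPDO.eLpNorm_top_ne_top g).lt_top
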